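/- **Setting.** A *2-group* is a monoidal groupoid $\mathbb G$ in which every object is weakly invertible; $\pi_0(\mathbb G)$ is the group of isomorphism classes of its objects. $\underline{\mathbb G}$ is the one-object bicategory with 1-morphisms the objects of $\mathbb G$, composed by $A\circ B=A\otimes B$, and 2-morphisms the morphisms of $\mathbb G$. $\mathbf{2Mat}_{\mathbb C}$ is the following 2-category. Its objects are the integers $n\ge 0$. A 1-morphism $n\to m$ is a pair $(\mathbf R,s)$ of an $m\times n$ matrix $\mathbf R$ of natural numbers (rank matrix) and a gauge $s$, that is, matrices $s_i(a)\in GL_{(\mathbf R a)_i}(\mathbb C)$ for $1\le i\le m$ and $a\in\mathbb N^n$, with $s_i(e_j)=\mathbf I$ for the standard basis vectors $e_j$. A 2-morphism $(\mathbf R,s)\Rightarrow(\bar{\mathbf R},\bar s)$ is a family of complex $\bar R_{ij}\times R_{ij}$ matrices $\mathsf T_{ij}$. Vertical composition is entrywise multiplication. The composite $(\mathbf R',s')\circ(\mathbf R,s)$ is $(\mathbf R'\mathbf R,\hat s)$ with $$\hat s_k(a)=s'_k(\mathbf R a)\Big(\bigoplus_i \mathbf I_{R'_{ki}}\otimes s_i(a)\Big)\,\mathbf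 P_k(a)\,\Big(\bigoplus_j s'_k(\mathbf R e_j)\otimes \mathbf I_{a_j}\Big)^{-1},$$ where $\mathbf P_k(a)$ is the permutation matrix of the distributivity bijection between the lexicographically ordered bases of $\bigoplus_j(\bigoplus_i\mathbb C^{R'_{ki}}\otimes\mathbb C^{R_{ij}})\otimes\mathbb C^{a_j}$ and $\bigoplus_i\mathbb C^{R'_{ki}}\otimes(\bigoplus_j\mathbb C^{R_{ij}}\otimes\mathbb C^{a_j})$. Horizontal composition is $$(\mathsf T'\circ\mathsf T)_{kj}=\bar s'_k(\bar{\mathbf R}e_j)\Big(\bigoplus_i\mathsf T'_{ki}\otimes\mathsf T_{ij}\Big)s'_k(\mathbf R e_j)^{-1}.$$ A 1-morphism is *gauge trivial* if all $s_i(a)$ are identity matrices. $\mathfrak{Rep}_{\mathbf{2Mat}_{\mathbb C}}(\mathbb G)$ is the bicategory of pseudofunctors $\underline{\mathbb G}\to\mathbf{2Mat}_{\mathbb C}$, pseudonatural transformations (1-intertwiners) and modifications. For a bicategory $\mathfrak C$, $\mathsf{Ho}(\mathfrak C)$ is the category with the same objects and with isomorphism classes of 1-morphisms as morphisms; a category $\mathcal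 C$, seen as a locally discrete 2-category $\mathcal C[0]$, has $\mathsf{Ho}(\mathcal C[0])=\mathcal C$. $\mathbf{Rep}_{\mathbf{FinSets}}(\pi_0(\mathbb G))$ is the category of finite sets with an action of $\pi_0(\mathbb G)$ and equivariant maps. Choose an enumeration (a total order) of every finite set, so that each object becomes a pair $(n,\rho)$, with $\rho:\pi_0(\mathbb G)\to S_n$ a homomorphism and $n\geq 0$. **Theorem.** Let $\mathbb G$ be a 2-group. There is a pseudofunctor $$\mathcal F:\mathbf{Rep}_{\mathbf{FinSets}}(\pi_0(\mathbb G))[0]\to\mathfrak{Rep}_{\mathbf{2Mat}_{\mathbb C}}(\mathbb G)$$ such that 1. $\mathcal F(n,\rho)$ is the purely permutational representation: it sends the unique object to $n$ and each object $A$ of $\mathbb G$ to the gauge trivial 1-morphism with rank matrix the permutation matrix $\mathbf P(\rho[A])$, where $\mathbf P(\sigma)_{ij}=\delta_{i,\sigma(j)}$; all the entries of its images of 2-morphisms and of its structural 2-isomorphisms are identity matrices; 2. $\mathcal F$ sends an equivariant map $f:(n,\rho)\to(n',\rho')$ to the 1-intertwiner whose 1-morphism $n\to n'$ is gauge trivial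 with rank matrix $\mathbf R(f)_{i'i}=\delta_{i',f(i)}$, and all of whose naturality 2-isomorphisms have identity matrices as entries; 3. $\mathcal F$ preserves identity 1-morphisms strictly, and the 2-isomorphisms relating $\mathcal F(f'\circ f)$ and $\mathcal F(f')\circ\mathcal F(f)$ have identity matrices as entries; 4. the induced functor $\mathsf{Ho}(\mathcal F):\mathbf{Rep}_{\mathbf{FinSets}}(\pi_0(\mathbb G))\to\mathsf{Ho}(\mathfrak{Rep}_{\mathbf{2Mat}_{\mathbb C}}(\mathbb G))$ is faithful and essentially injective (objects with isomorphic images are isomorphic). **Corollary.** $\mathbf{Rep}_{\mathbf{FinSets}}(\pi_0(\mathbb G))$ is equivalent to a (not necessarily full) subcategory of $\mathsf{Ho}(\mathfrak{Rep}_{\mathbf{2Mat}_{\mathbb C}}(\mathbb G))$. -/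

import Mathlib

open CategoryTheory Bicategory
open scoped CategoryTheory.Pseudofunctor.StrongTrans

universe w v u w₁ w₂ v₁ v₂ u₁ u₂

noncomputable section

open MonoidalCategory
open scoped Matrix Kronecker

set_option linter.unusedVariables false
set_option linter.unusedSectionVars false

namespace TwoMatrix

/-- The lexicographic enumeration of the standard basis of `⨁ j, ℂ ^ (r j) ⊗ ℂ ^ (a j)`. -/
def enum {n : ℕ} (r a : Fin n → ℕ) :
    (Σ j : Fin n, Fin (r j) × Fin (a j)) ≃ Fin (∑ j, r j * a j) :=
  (Equiv.sigmaCongrRight fun _ => finProdFinEquiv).trans finSigmaFinEquiv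

/-- The matrix `⨁ j, A j ⊗ B j` (direct sum of Kronecker products). -/
def dsum {n : ℕ} {r r' a a' : Fin n → ℕ} (A : ∀ j, Matrix (Fin (r' j)) (Fin (r j)) ℂ)
    (B : ∀ j, Matrix (Fin (a' j)) (Fin (a j)) ℂ) :
    Matrix (Fin (∑ j, r' j * a' j)) (Fin (∑ j, r j * a j)) ℂ :=
  (Matrix.blockDiagonal' fun j => A j ⊗ₖ B j).submatrix (enum r' a').symm (enum r a).symm

/-- The `q × p` matrix with entries `δ r c`. It is only used for `p = q`, when it is the identity
matrix, in order to compare matrices whose sizes are equal but not syntactically so. -/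
def idMat (p q : ℕ) : Matrix (Fin q) (Fin p) ℂ := fun r c => if (r : ℕ) = c then 1 else 0

/-- The permutation matrix of a bijection. -/
def permMat {p q : ℕ} (e : Fin p ≃ Fin q) : Matrix (Fin q) (Fin p) ℂ :=
  fun y x => if y = e x then 1 else 0

theorem dsum_mul {n : ℕ} {r r' r'' a a' a'' : Fin n → ℕ}
    (A : ∀ j, Matrix (Fin (r' j)) (Fin (r j)) ℂ) (A' : ∀ j, Matrix (Fin (r'' j)) (Fin (r' j)) ℂ)
    (B : ∀ j, Matrix (Fin (a' j)) (Fin (a j)) ℂ) (B' : ∀ j, Matrix (Fin (a'' j)) (Fin (a' j)) ℂ) :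
    dsum A' B' * dsum A B = dsum (fun j => A' j * A j) (fun j => B' j * B j) := by
  unfold dsum
  rw [Matrix.submatrix_mul_equiv, ← Matrix.blockDiagonal'_mul]
  simp only [Matrix.mul_kronecker_mul]

theorem dsum_one {n : ℕ} (r a : Fin n → ℕ) :
    dsum (fun j => (1 : Matrix (Fin (r j)) (Fin (r j)) ℂ))
      (fun j => (1 : Matrix (Fin (a j)) (Fin (a j)) ℂ)) = 1 := by
  unfold dsum
  simp only [Matrix.one_kronecker_one]
  have := Matrix.blockDiagonal'_one (m' := fun j => Fin (r j) × Fin (a j)) (α := ℂ)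
  simp only [Pi.one_def] at this
  rw [this]
  exact Matrix.submatrix_one_equiv _

theorem idMat_self (p : ℕ) : idMat p p = 1 := by
  ext r c
  simp [idMat, Matrix.one_apply, Fin.ext_iff]

theorem idMat_mul {p q r : ℕ} (h : p = q) : idMat q r * idMat p q = idMat p r := by
  subst h; rw [idMat_self, Matrix.mul_one]

theorem idMat_mul' {p q r : ℕ} (h : q = r) : idMat q r * idMat p q = idMat p r := by
  subst h; rw [idMat_self, Matrix.one_mul]

theorem permMat_symm_mul {p q : ℕ} (e : Fin p ≃ Fin q) : permMat e.symm * permMat e = 1 := by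
  ext x y
  simp [permMat, Matrix.mul_apply, Matrix.one_apply, Equiv.eq_symm_apply]

theorem permMat_mul_symm {p q : ℕ} (e : Fin p ≃ Fin q) : permMat e * permMat e.symm = 1 := by
  simpa using permMat_symm_mul e.symm

/-- Distributivity of `×` over disjoint unions, on standard bases. -/
def distrib {n m : ℕ} (t : Fin m → ℕ) (R : Fin m → Fin n → ℕ) (a : Fin n → ℕ) :
    (Σ j : Fin n, (Σ i : Fin m, Fin (t i) × Fin (R i j)) × Fin (a j)) ≃
      (Σ i : Fin m, Fin (t i) × (Σ j : Fin n, Fin (R i j) × Fin (a j))) where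
  toFun := fun ⟨j, ⟨i, u, r⟩, x⟩ => ⟨i, u, ⟨j, r, x⟩⟩
  invFun := fun ⟨i, u, ⟨j, r, x⟩⟩ => ⟨j, ⟨i, u, r⟩, x⟩
  left_inv := fun _ => rfl
  right_inv := fun _ => rfl

/-- The lexicographic enumeration of the basis of
`⨁ j, (⨁ i, ℂ ^ (t i) ⊗ ℂ ^ (R i j)) ⊗ ℂ ^ (a j)`. -/
def enumLeft {n m : ℕ} (t : Fin m → ℕ) (R : Fin m → Fin n → ℕ) (a : Fin n → ℕ) :
    (Σ j : Fin n, (Σ i : Fin m, Fin (t i) × Fin (R i j)) × Fin (a j)) ≃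
      Fin (∑ j, (∑ i, t i * R i j) * a j) :=
  (Equiv.sigmaCongrRight fun j => (enum t (fun i => R i j)).prodCongr (Equiv.refl _)).trans
    (enum (fun j => ∑ i, t i * R i j) a)

/-- The lexicographic enumeration of the basis of
`⨁ i, ℂ ^ (t i) ⊗ (⨁ j, ℂ ^ (R i j) ⊗ ℂ ^ (a j))`. -/
def enumRight {n m : ℕ} (t : Fin m → ℕ) (R : Fin m → Fin n → ℕ) (a : Fin n → ℕ) :
    (Σ i : Fin m, Fin (t i) × (Σ j : Fin n, Fin (R i j) × Fin (a j))) ≃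
      Fin (∑ i, t i * ∑ j, R i j * a j) :=
  (Equiv.sigmaCongrRight fun i => (Equiv.refl _).prodCongr (enum (R i) a)).trans
    (enum t (fun i => ∑ j, R i j * a j))

/-- The canonical bijection, by distributivity, between the bases of
`⨁ j, (⨁ i, ℂ ^ (t i) ⊗ ℂ ^ (R i j)) ⊗ ℂ ^ (a j)` and of
`⨁ i, ℂ ^ (t i) ⊗ (⨁ j, ℂ ^ (R i j) ⊗ ℂ ^ (a j))`, both enumerated lexicographically. -/
def shuffle {n m : ℕ} (t : Fin m → ℕ) (R : Fin m → Fin n → ℕ) (a : Fin n → ℕ) :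
    Fin (∑ j, (∑ i, t i * R i j) * a j) ≃ Fin (∑ i, t i * ∑ j, R i j * a j) :=
  (enumLeft t R a).symm.trans ((distrib t R a).trans (enumRight t R a))

theorem dsum_enum {n : ℕ} {r r' a a' : Fin n → ℕ} (A : ∀ j, Matrix (Fin (r' j)) (Fin (r j)) ℂ)
    (B : ∀ j, Matrix (Fin (a' j)) (Fin (a j)) ℂ) (j : Fin n) (u : Fin (r' j)) (x : Fin (a' j))
    (j' : Fin n) (u' : Fin (r j')) (x' : Fin (a j')) :
    dsum A B (enum r' a' ⟨j, u, x⟩) (enum r a ⟨j', u', x'⟩) =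
      if h : j = j' then A j u (h ▸ u') * B j x (h ▸ x') else 0 := by
  unfold dsum
  by_cases h : j = j'
  · subst h
    simp [Matrix.blockDiagonal'_apply_eq]
  · simp [Matrix.blockDiagonal'_apply_ne _ _ _ h, h]

theorem permMat_mul_apply {p q s : ℕ} (e : Fin p ≃ Fin q) (M : Matrix (Fin p) (Fin s) ℂ)
    (x : Fin p) (z : Fin s) : (permMat e * M) (e x) z = M x z := by
  simp [permMat, Matrix.mul_apply]

theorem mul_permMat_apply {p q s : ℕ} (e : Fin p ≃ Fin q) (M : Matrix (Fin s) (Fin q) ℂ)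
    (z : Fin s) (x : Fin p) : (M * permMat e) z x = M z (e x) := by
  simp [permMat, Matrix.mul_apply]

/-- Naturality of the distributivity bijection. -/
theorem permMat_shuffle_mul {n m : ℕ} {t t' : Fin m → ℕ} {R R' : Fin m → Fin n → ℕ}
    {a a' : Fin n → ℕ} (A : ∀ i, Matrix (Fin (t' i)) (Fin (t i)) ℂ)
    (B : ∀ i j, Matrix (Fin (R' i j)) (Fin (R i j)) ℂ)
    (C : ∀ j, Matrix (Fin (a' j)) (Fin (a j)) ℂ) :
    permMat (shuffle t' R' a') * dsum (fun j => dsum A (fun i => B i j)) C =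
      dsum A (fun i => dsum (B i) C) * permMat (shuffle t R a) := by
  ext y z
  obtain ⟨y, rfl⟩ := (shuffle t' R' a').surjective y
  rw [permMat_mul_apply, mul_permMat_apply]
  obtain ⟨⟨j, ⟨i, u, r⟩, x⟩, rfl⟩ := (enumLeft t' R' a').surjective y
  obtain ⟨⟨j', ⟨i', u', r'⟩, x'⟩, rfl⟩ := (enumLeft t R a).surjective z
  have h1 : shuffle t' R' a' (enumLeft t' R' a' ⟨j, ⟨i, u, r⟩, x⟩) =
    enum t' (fun i => ∑ j, R' i j * a' j) ⟨i, u, enum (R' i) a' ⟨j, r, x⟩⟩ := by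
    simp [shuffle, distrib, enumRight]
  have h2 : shuffle t R a (enumLeft t R a ⟨j', ⟨i', u', r'⟩, x'⟩) =
    enum t (fun i => ∑ j, R i j * a j) ⟨i', u', enum (R i') a ⟨j', r', x'⟩⟩ := by
    simp [shuffle, distrib, enumRight]
  have h3 : enumLeft t' R' a' ⟨j, ⟨i, u, r⟩, x⟩ =
    enum (fun j => ∑ i, t' i * R' i j) a' ⟨j, enum t' (fun i => R' i j) ⟨i, u, r⟩, x⟩ := rfl
  have h4 : enumLeft t R a ⟨j', ⟨i', u', r'⟩, x'⟩ =
    enum (fun j => ∑ i, t i * R i j) a ⟨j', enum t (fun i => R i j') ⟨i', u', r'⟩, x'⟩ := rfl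
  rw [h1, h2, h3, h4, dsum_enum, dsum_enum]
  by_cases hj : j = j'
  · subst hj
    by_cases hi : i = i'
    · subst hi
      simp [dsum_enum, mul_assoc]
    · simp [dsum_enum, hi]
  · by_cases hi : i = i'
    · subst hi
      simp [dsum_enum, hj]
    · simp [hi, hj]

theorem idMat_mul_mul_apply {p p' q q' : ℕ} (A : Matrix (Fin p') (Fin p) ℂ) {y : Fin q'}
    {z : Fin q} {u : Fin p'} {v : Fin p} (hy : (y : ℕ) = u) (hz : (z : ℕ) = v) :
    (idMat p' q' * A * idMat q p) y z = A u v := by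
  have h1 : ∀ w : Fin p', idMat p' q' y w = if w = u then 1 else 0 := fun w => by
    simp only [idMat, hy, Fin.ext_iff, eq_comm]
  have h2 : ∀ w : Fin p, idMat q p w z = if w = v then 1 else 0 := fun w => by
    simp only [idMat, hz, Fin.ext_iff]
  simp [Matrix.mul_apply, h1, h2]

theorem sum_mul_unit {n : ℕ} (r : Fin n → ℕ) (j : Fin n) {a : Fin n → ℕ}
    (ha : ∀ i, a i = if i = j then 1 else 0) : ∑ i, r i * a i = r j := by
  simp [ha]

theorem sum_unit_mul {n : ℕ} (r : Fin n → ℕ) (j : Fin n) {a : Fin n → ℕ}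
    (ha : ∀ i, a i = if i = j then 1 else 0) : ∑ i, a i * r i = r j := by
  simp [ha]

theorem enum_val {n : ℕ} (r a : Fin n → ℕ) (j : Fin n) (u : Fin (r j)) (x : Fin (a j)) :
    (enum r a ⟨j, u, x⟩ : ℕ) =
      ∑ i : Fin j, r (Fin.castLE j.2.le i) * a (Fin.castLE j.2.le i) + (x + a j * u) := by
  simp [enum, finSigmaFinEquiv_apply, finProdFinEquiv]

theorem sum_castLE_eq_zero {n : ℕ} (f : Fin n → ℕ) (j : Fin n) (h : ∀ i, i ≠ j → f i = 0) :
    ∑ i : Fin j, f (Fin.castLE j.2.le i) = 0 :=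
  Finset.sum_eq_zero fun i _ => h _ fun hi => by
    have := congrArg Fin.val hi
    have := i.2
    simp at *
    omega

theorem enum_val_unit_right {n : ℕ} (r : Fin n → ℕ) {a : Fin n → ℕ} (j : Fin n)
    (ha : ∀ i, a i = if i = j then 1 else 0) (u : Fin (r j)) (x : Fin (a j)) :
    (enum r a ⟨j, u, x⟩ : ℕ) = u := by
  have h1 : a j = 1 := by simp [ha]
  have h2 : (x : ℕ) = 0 := by have := x.2; omega
  rw [enum_val, sum_castLE_eq_zero (fun i => r i * a i) j (fun i hi => by simp [ha, hi]), h2]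
  simp [h1]

theorem enum_val_unit_left {n : ℕ} {t : Fin n → ℕ} (a : Fin n → ℕ) (j : Fin n)
    (ht : ∀ i, t i = if i = j then 1 else 0) (u : Fin (t j)) (x : Fin (a j)) :
    (enum t a ⟨j, u, x⟩ : ℕ) = x := by
  have h1 : t j = 1 := by simp [ht]
  have h2 : (u : ℕ) = 0 := by have := u.2; omega
  rw [enum_val, sum_castLE_eq_zero (fun i => t i * a i) j (fun i hi => by simp [ht, hi]), h2]
  omega

theorem dsum_unit_right {n : ℕ} {r r' : Fin n → ℕ} (A : ∀ j, Matrix (Fin (r' j)) (Fin (r j)) ℂ)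
    (j : Fin n) {a : Fin n → ℕ} (ha : ∀ i, a i = if i = j then 1 else 0) :
    dsum A (fun i => (1 : Matrix (Fin (a i)) (Fin (a i)) ℂ)) =
      idMat (r' j) (∑ i, r' i * a i) * A j * idMat (∑ i, r i * a i) (r j) := by
  have key : ∀ (i : Fin n), Fin (a i) → i = j := fun i x => by
    by_contra h
    have := x.2
    simp [ha, h] at this
  ext y z
  obtain ⟨⟨i, u, x⟩, rfl⟩ := (enum r' a).surjective y
  obtain ⟨⟨i', u', x'⟩, rfl⟩ := (enum r a).surjective z
  obtain rfl := key i x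
  obtain rfl := key i' x'
  rw [idMat_mul_mul_apply (A i') (enum_val_unit_right r' i' ha u x)
    (enum_val_unit_right r i' ha u' x'), dsum_enum]
  have hs : Subsingleton (Fin (a i')) := by
    have h1 : a i' = 1 := by simp [ha]
    rw [h1]; infer_instance
  obtain rfl : x = x' := Subsingleton.elim _ _
  rw [dif_pos rfl]
  simp

theorem dsum_unit_left {n : ℕ} {a a' : Fin n → ℕ} (B : ∀ j, Matrix (Fin (a' j)) (Fin (a j)) ℂ)
    (j : Fin n) {t : Fin n → ℕ} (ht : ∀ i, t i = if i = j then 1 else 0) :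
    dsum (fun i => (1 : Matrix (Fin (t i)) (Fin (t i)) ℂ)) B =
      idMat (a' j) (∑ i, t i * a' i) * B j * idMat (∑ i, t i * a i) (a j) := by
  have key : ∀ (i : Fin n), Fin (t i) → i = j := fun i x => by
    by_contra h
    have := x.2
    simp [ht, h] at this
  ext y z
  obtain ⟨⟨i, u, x⟩, rfl⟩ := (enum t a').surjective y
  obtain ⟨⟨i', u', x'⟩, rfl⟩ := (enum t a).surjective z
  obtain rfl := key i u
  obtain rfl := key i' u'
  rw [idMat_mul_mul_apply (B i') (enum_val_unit_left a' i' ht u x)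
    (enum_val_unit_left a i' ht u' x'), dsum_enum]
  have hs : Subsingleton (Fin (t i')) := by
    have h1 : t i' = 1 := by simp [ht]
    rw [h1]; infer_instance
  obtain rfl : u = u' := Subsingleton.elim _ _
  rw [dif_pos rfl]
  simp

/-- When the last vector is a standard basis vector, the distributivity bijection is trivial. -/
theorem permMat_shuffle_unit {n m : ℕ} (t : Fin m → ℕ) (R : Fin m → Fin n → ℕ) (j : Fin n)
    {a : Fin n → ℕ} (ha : ∀ i, a i = if i = j then 1 else 0) :
    permMat (shuffle t R a) = idMat _ _ := by
  have key : ∀ (i : Fin n), Fin (a i) → i = j := fun i x => by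
    by_contra h
    have := x.2
    simp [ha, h] at this
  ext y z
  obtain ⟨y, rfl⟩ := (shuffle t R a).surjective y
  obtain ⟨⟨i, ⟨k, u, r⟩, x⟩, rfl⟩ := (enumLeft t R a).surjective y
  obtain rfl := key i x
  have hval : ∀ w, (shuffle t R a w : ℕ) = w := fun w => by
    obtain ⟨⟨i', ⟨k', u', r'⟩, x'⟩, rfl⟩ := (enumLeft t R a).surjective w
    obtain rfl := key i' x'
    have h1 : shuffle t R a (enumLeft t R a ⟨i', ⟨k', u', r'⟩, x'⟩) =
        enum t (fun i => ∑ j, R i j * a j) ⟨k', u', enum (R k') a ⟨i', r', x'⟩⟩ := by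
      simp [shuffle, distrib, enumRight]
    have h2 : enumLeft t R a ⟨i', ⟨k', u', r'⟩, x'⟩ =
      enum (fun j => ∑ i, t i * R i j) a ⟨i', enum t (fun i => R i i') ⟨k', u', r'⟩, x'⟩ := rfl
    have e1 := enum_val t (fun i => ∑ j, R i j * a j) k' u' (enum (R k') a ⟨i', r', x'⟩)
    rw [enum_val_unit_right (R k') i' ha] at e1
    rw [h1, h2, enum_val_unit_right _ i' ha, e1, enum_val]
    simp only [sum_mul_unit _ i' ha]
  simp [permMat, idMat, hval, Fin.ext_iff]

theorem shuffle_val {n m : ℕ} (t : Fin m → ℕ) (R : Fin m → Fin n → ℕ) (a : Fin n → ℕ)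
    (i : Fin m) (j : Fin n) (u : Fin (t i)) (r : Fin (R i j)) (x : Fin (a j)) :
    shuffle t R a (enum (fun j => ∑ i, t i * R i j) a ⟨j, enum t (fun i => R i j) ⟨i, u, r⟩, x⟩) =
      enum t (fun i => ∑ j, R i j * a j) ⟨i, u, enum (R i) a ⟨j, r, x⟩⟩ := by
  change shuffle t R a (enumLeft t R a ⟨j, ⟨i, u, r⟩, x⟩) = _
  simp [shuffle, distrib, enumRight]

theorem permMat_shuffle_eq_idMat {n m : ℕ} (t : Fin m → ℕ) (R : Fin m → Fin n → ℕ)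
    (a : Fin n → ℕ)
    (h : ∀ (i : Fin m) (j : Fin n) (u : Fin (t i)) (r : Fin (R i j)) (x : Fin (a j)),
      (enum t (fun i => ∑ j, R i j * a j) ⟨i, u, enum (R i) a ⟨j, r, x⟩⟩ : ℕ) =
        enum (fun j => ∑ i, t i * R i j) a ⟨j, enum t (fun i => R i j) ⟨i, u, r⟩, x⟩) :
    permMat (shuffle t R a) = idMat _ _ := by
  ext y z
  obtain ⟨⟨j, ⟨i, u, r⟩, x⟩, rfl⟩ := (enumLeft t R a).surjective z
  have h2 : enumLeft t R a ⟨j, ⟨i, u, r⟩, x⟩ =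
      enum (fun j => ∑ i, t i * R i j) a ⟨j, enum t (fun i => R i j) ⟨i, u, r⟩, x⟩ := rfl
  rw [h2]
  simp only [permMat, idMat, shuffle_val, Fin.ext_iff, h]

/-- When the first vector is a standard basis vector, the distributivity bijection is trivial. -/
theorem permMat_shuffle_unit_left {n m : ℕ} {t : Fin m → ℕ} (R : Fin m → Fin n → ℕ)
    (a : Fin n → ℕ) (k : Fin m) (ht : ∀ i, t i = if i = k then 1 else 0) :
    permMat (shuffle t R a) = idMat _ _ := by
  refine permMat_shuffle_eq_idMat _ _ _ fun i j u r x => ?_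
  obtain rfl : i = k := by
    by_contra h
    have := u.2
    simp [ht, h] at this
  rw [enum_val_unit_left _ i ht, enum_val, enum_val, enum_val_unit_left _ i ht]
  simp only [sum_unit_mul _ i ht]

/-- When the rank matrix is an identity matrix, the distributivity bijection is trivial. -/
theorem permMat_shuffle_id {n : ℕ} (t : Fin n → ℕ) (a : Fin n → ℕ) :
    permMat (shuffle t (fun i j => if i = j then 1 else 0) a) = idMat _ _ := by
  refine permMat_shuffle_eq_idMat _ _ _ fun i j u r x => ?_
  obtain rfl : i = j := by
    by_contra h
    have := r.2
    simp [h] at this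
  have h1 : ∀ j, (if i = j then 1 else 0) = if j = i then 1 else 0 := fun j => by
    simp only [eq_comm]
  have e1 := enum_val t (fun i => ∑ j, (if i = j then 1 else 0) * a j) i u
    (enum (fun j => if i = j then 1 else 0) a ⟨i, r, x⟩)
  have e2 := enum_val (fun j => ∑ k, t k * if k = j then 1 else 0) a i
    (enum t (fun k => if k = i then 1 else 0) ⟨i, u, r⟩) x
  rw [enum_val_unit_left (t := fun j => if i = j then 1 else 0) a i h1 r x] at e1
  rw [enum_val_unit_right (a := fun k => if k = i then 1 else 0) t i (fun _ => rfl) u r] at e2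
  rw [e1, e2]
  simp

theorem permMat_mul {p q r : ℕ} (e : Fin p ≃ Fin q) (e' : Fin q ≃ Fin r) :
    permMat e' * permMat e = permMat (e.trans e') := by
  ext y x
  rw [mul_permMat_apply]
  rfl

theorem idMat_mul_idMat {p q : ℕ} (h : p = q) : idMat q p * idMat p q = 1 := by
  subst h; rw [idMat_self, Matrix.mul_one]

theorem dsum_one_of {n : ℕ} {r a : Fin n → ℕ} {A : ∀ j, Matrix (Fin (r j)) (Fin (r j)) ℂ}
    {B : ∀ j, Matrix (Fin (a j)) (Fin (a j)) ℂ} (hA : ∀ j, A j = 1) (hB : ∀ j, B j = 1) :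
    dsum A B = 1 := by
  obtain rfl : A = fun j => 1 := funext hA
  obtain rfl : B = fun j => 1 := funext hB
  exact dsum_one r a

theorem dsum_one_idMat {n : ℕ} (r : Fin n → ℕ) {a a' : Fin n → ℕ} (h : a = a') :
    dsum (fun j => (1 : Matrix (Fin (r j)) (Fin (r j)) ℂ)) (fun j => idMat (a j) (a' j)) =
      idMat _ _ := by
  subst h
  rw [idMat_self]
  exact dsum_one_of (fun _ => rfl) (fun _ => idMat_self _)

theorem dsum_idMat_one {n : ℕ} {r r' : Fin n → ℕ} (a : Fin n → ℕ) (h : r = r') :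
    dsum (fun j => idMat (r j) (r' j)) (fun j => (1 : Matrix (Fin (a j)) (Fin (a j)) ℂ)) =
      idMat _ _ := by
  subst h
  rw [idMat_self]
  exact dsum_one_of (fun _ => idMat_self _) (fun _ => rfl)

theorem dsum_permMat_one {n : ℕ} {r r' : Fin n → ℕ} (a : Fin n → ℕ)
    (e : ∀ j, Fin (r j) ≃ Fin (r' j)) :
    dsum (fun j => permMat (e j)) (fun j => (1 : Matrix (Fin (a j)) (Fin (a j)) ℂ)) =
      permMat ((enum r a).symm.trans ((Equiv.sigmaCongrRight fun j =>
        (e j).prodCongr (Equiv.refl _)).trans (enum r' a))) := by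
  ext y z
  obtain ⟨⟨i, u, x⟩, rfl⟩ := (enum r' a).surjective y
  obtain ⟨⟨i', u', x'⟩, rfl⟩ := (enum r a).surjective z
  rw [dsum_enum]
  by_cases h : i = i'
  · subst h
    rw [dif_pos rfl]
    simp only [permMat, Matrix.one_apply, Equiv.trans_apply, Equiv.symm_apply_apply,
      Equiv.sigmaCongrRight_apply, Equiv.prodCongr_apply, Prod.map, Equiv.refl_apply,
      EmbeddingLike.apply_eq_iff_eq, Sigma.mk.injEq, true_and, heq_eq_eq, Prod.mk.injEq]
    split_ifs <;> simp_all
  · rw [dif_neg h]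
    simp [permMat, h]

theorem dsum_one_permMat {n : ℕ} (r : Fin n → ℕ) {a a' : Fin n → ℕ}
    (e : ∀ j, Fin (a j) ≃ Fin (a' j)) :
    dsum (fun j => (1 : Matrix (Fin (r j)) (Fin (r j)) ℂ)) (fun j => permMat (e j)) =
      permMat ((enum r a).symm.trans ((Equiv.sigmaCongrRight fun j =>
        (Equiv.refl _).prodCongr (e j)).trans (enum r a'))) := by
  ext y z
  obtain ⟨⟨i, u, x⟩, rfl⟩ := (enum r a').surjective y
  obtain ⟨⟨i', u', x'⟩, rfl⟩ := (enum r a).surjective z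
  rw [dsum_enum]
  by_cases h : i = i'
  · subst h
    rw [dif_pos rfl]
    simp only [permMat, Matrix.one_apply, Equiv.trans_apply, Equiv.symm_apply_apply,
      Equiv.sigmaCongrRight_apply, Equiv.prodCongr_apply, Prod.map, Equiv.refl_apply,
      EmbeddingLike.apply_eq_iff_eq, Sigma.mk.injEq, true_and, heq_eq_eq, Prod.mk.injEq]
    split_ifs <;> simp_all
  · rw [dif_neg h]
    simp [permMat, h]

/-- Coherence of the distributivity bijections. -/
theorem permMat_shuffle_coherence {n m p : ℕ} (t : Fin p → ℕ) (Q : Fin p → Fin m → ℕ)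
    (R : Fin m → Fin n → ℕ) (a : Fin n → ℕ) :
    dsum (fun k => (1 : Matrix (Fin (t k)) (Fin (t k)) ℂ))
        (fun k => permMat (shuffle (Q k) R a)) *
      (permMat (shuffle t (fun k j => ∑ i, Q k i * R i j) a) *
        dsum (fun j => permMat (shuffle t Q (fun i => R i j)))
          (fun j => (1 : Matrix (Fin (a j)) (Fin (a j)) ℂ))) =
    permMat (shuffle t Q (fun i => ∑ j, R i j * a j)) *
      permMat (shuffle (fun i => ∑ k, t k * Q k i) R a) := by
  rw [dsum_one_permMat, dsum_permMat_one, permMat_mul, permMat_mul, permMat_mul]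
  congr 1
  ext z
  congr 1
  obtain ⟨⟨j, v, x⟩, rfl⟩ := (enum _ a).surjective z
  obtain ⟨⟨i, w, r⟩, rfl⟩ := (enum _ (fun i => R i j)).surjective v
  obtain ⟨⟨k, u, q⟩, rfl⟩ := (enum t (fun k => Q k i)).surjective w
  simp only [Equiv.trans_apply, Equiv.symm_apply_apply, shuffle_val, Equiv.sigmaCongrRight_apply,
    Equiv.prodCongr_apply, Prod.map, Equiv.refl_apply]

/-- A 1-morphism `n ⟶ m` of 2-matrices: a rank matrix `R` together with a gauge, that is, matrices
`s i a ∈ GL (R(a) i)` for all `a ∈ ℕ ^ n`, where `R(a) i = ∑ j, R i j * a j`, which are identity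
matrices when `a` is a standard basis vector. -/
structure Mor (n m : ℕ) where
  /-- The rank matrix. -/
  rank : Fin m → Fin n → ℕ
  /-- The gauge. -/
  gauge (a : Fin n → ℕ) (i : Fin m) : GL (Fin (∑ j, rank i j * a j)) ℂ
  gauge_single (j : Fin n) (i : Fin m) : gauge (Pi.single j 1) i = 1

namespace Mor

/-- The 1-morphism with a given rank matrix and with trivial gauge. -/
@[simps]
def ofRank {n m : ℕ} (R : Fin m → Fin n → ℕ) : Mor n m where
  rank := R
  gauge _ _ := 1
  gauge_single _ _ := rfl

/-- The identity 1-morphism: identity rank matrix, trivial gauge. -/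
def id (n : ℕ) : Mor n n := ofRank fun i j => if i = j then 1 else 0

theorem gauge_unit {n m : ℕ} (F : Mor n m) (j : Fin n) {a : Fin n → ℕ}
    (ha : ∀ i, a i = if i = j then 1 else 0) (i : Fin m) : F.gauge a i = 1 := by
  obtain rfl : a = Pi.single j 1 := by ext i; rw [ha, Pi.single_apply]
  exact F.gauge_single j i

/-- The gauge `s' * s` of the composite of `F = (R, s) : n ⟶ m` and `G = (R', s') : m ⟶ p`, at
`a ∈ ℕ ^ n`: it is
`s' k (R(a)) * (⨁ i, 1 ⊗ s i a) * P * (⨁ j, (s' k (R(e j)))⁻¹ ⊗ 1)`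
for the permutation matrix `P` of the distributivity bijection. The factor `idMat` identifies
`Fin (R'(R(a)) k)` with `Fin ((R' R)(a) k)`. -/
def compGauge {n m p : ℕ} (F : Mor n m) (G : Mor m p) (a : Fin n → ℕ) (k : Fin p) :
    Matrix (Fin (∑ j, (∑ i, G.rank k i * F.rank i j) * a j))
      (Fin (∑ j, (∑ i, G.rank k i * F.rank i j) * a j)) ℂ :=
  idMat (∑ i, G.rank k i * ∑ j, F.rank i j * a j) (∑ j, (∑ i, G.rank k i * F.rank i j) * a j) *
    ((G.gauge (fun i => ∑ j, F.rank i j * a j) k).val *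
      (dsum (fun i => (1 : Matrix (Fin (G.rank k i)) (Fin (G.rank k i)) ℂ))
          (fun i => (F.gauge a i).val) *
        (permMat (shuffle (G.rank k) F.rank a) *
          dsum (fun j => ((G.gauge (fun i => F.rank i j) k)⁻¹).val)
            (fun j => (1 : Matrix (Fin (a j)) (Fin (a j)) ℂ)))))

/-- The inverse of `compGauge`. -/
def compGaugeInv {n m p : ℕ} (F : Mor n m) (G : Mor m p) (a : Fin n → ℕ) (k : Fin p) :
    Matrix (Fin (∑ j, (∑ i, G.rank k i * F.rank i j) * a j))
      (Fin (∑ j, (∑ i, G.rank k i * F.rank i j) * a j)) ℂ :=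
  ((((dsum (fun j => (G.gauge (fun i => F.rank i j) k).val)
            (fun j => (1 : Matrix (Fin (a j)) (Fin (a j)) ℂ)) *
          permMat (shuffle (G.rank k) F.rank a).symm) *
        dsum (fun i => (1 : Matrix (Fin (G.rank k i)) (Fin (G.rank k i)) ℂ))
          (fun i => ((F.gauge a i)⁻¹).val)) *
      ((G.gauge (fun i => ∑ j, F.rank i j * a j) k)⁻¹).val) *
    idMat (∑ j, (∑ i, G.rank k i * F.rank i j) * a j) (∑ i, G.rank k i * ∑ j, F.rank i j * a j))

theorem act_act {n m : ℕ} (t : Fin m → ℕ) (R : Fin m → Fin n → ℕ) (a : Fin n → ℕ) :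
    ∑ i, t i * ∑ j, R i j * a j = ∑ j, (∑ i, t i * R i j) * a j :=
  Fin.equiv_iff_eq.mp ⟨(shuffle t R a).symm⟩

end Mor

theorem inv_chain {p q r : ℕ} {A : Matrix (Fin p) (Fin q) ℂ} {A' : Matrix (Fin q) (Fin p) ℂ}
    {B : Matrix (Fin q) (Fin r) ℂ} {B' : Matrix (Fin r) (Fin q) ℂ}
    (h : A * A' = 1) (h' : B * B' = 1) : (A * B) * (B' * A') = 1 := by
  rw [Matrix.mul_assoc, ← Matrix.mul_assoc B, h', Matrix.one_mul, h]

namespace Mor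

theorem compGauge_mul_inv {n m p : ℕ} (F : Mor n m) (G : Mor m p) (a : Fin n → ℕ) (k : Fin p) :
    compGauge F G a k * compGaugeInv F G a k = 1 := by
  unfold compGauge compGaugeInv
  refine inv_chain (idMat_mul_idMat (act_act _ _ _).symm) (inv_chain ?_ (inv_chain ?_ (inv_chain (permMat_mul_symm _) ?_)))
  · simp
  · rw [dsum_mul]; exact dsum_one_of (by simp) (by simp)
  · rw [dsum_mul]; exact dsum_one_of (by simp) (by simp)

theorem compGaugeInv_mul {n m p : ℕ} (F : Mor n m) (G : Mor m p) (a : Fin n → ℕ) (k : Fin p) :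
    compGaugeInv F G a k * compGauge F G a k = 1 := by
  unfold compGauge compGaugeInv
  refine inv_chain (inv_chain (inv_chain (inv_chain ?_ (permMat_symm_mul _)) ?_) ?_)
    (idMat_mul_idMat (act_act _ _ _))
  · rw [dsum_mul]; exact dsum_one_of (by simp) (by simp)
  · rw [dsum_mul]; exact dsum_one_of (by simp) (by simp)
  · simp

theorem gauge_congr {n m : ℕ} (F : Mor n m) {a b : Fin n → ℕ} (h : a = b) (i : Fin m) :
    (F.gauge a i).val =
      (idMat (∑ j, F.rank i j * b j) (∑ j, F.rank i j * a j) * (F.gauge b i).val *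
        idMat (∑ j, F.rank i j * a j) (∑ j, F.rank i j * b j)) := by
  subst h
  rw [idMat_self, Matrix.mul_one, Matrix.one_mul]

theorem unit_cancel {K M N : ℕ} (hM : M = K) (hN : N = K) {X X' : Matrix (Fin K) (Fin K) ℂ}
    (hX : X * X' = 1) :
    idMat M N * ((idMat K M * X * idMat M K) * (idMat N M * (idMat K N * X' * idMat N K))) = 1 := by
  subst hM hN
  simp [idMat_self, hX]

theorem compGauge_unit {n m p : ℕ} (F : Mor n m) (G : Mor m p) (j : Fin n) {a : Fin n → ℕ}
    (ha : ∀ i, a i = if i = j then 1 else 0) (k : Fin p) : compGauge F G a k = 1 := by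
  unfold compGauge
  rw [permMat_shuffle_unit _ _ j ha, dsum_unit_right _ j ha, dsum_one_of (fun _ => rfl)
    (fun i => by rw [F.gauge_unit j ha]; rfl), Matrix.one_mul]
  have hb : (fun i => ∑ j, F.rank i j * a j) = fun i => F.rank i j := by
    funext i; exact sum_mul_unit _ j ha
  rw [G.gauge_congr hb]
  exact unit_cancel (by simp only [sum_mul_unit _ j ha]) (by simp only [sum_mul_unit _ j ha])
    (by simp)

/-- The composite of the 1-morphisms `F = (R, s) : n ⟶ m` and `G = (R', s') : m ⟶ p`. Its rank
matrix is the product `R' R`. -/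
def comp {n m p : ℕ} (F : Mor n m) (G : Mor m p) : Mor n p where
  rank k j := ∑ i, G.rank k i * F.rank i j
  gauge a k := ⟨compGauge F G a k, compGaugeInv F G a k, compGauge_mul_inv F G a k, compGaugeInv_mul F G a k⟩
  gauge_single j k := Units.ext (compGauge_unit F G j (fun i => Pi.single_apply j 1 i) k)

/-- The defining property of the gauge of a composite. -/
theorem comp_gauge_mul_dsum {n m p : ℕ} (F : Mor n m) (G : Mor m p) (a : Fin n → ℕ) (k : Fin p) :
    compGauge F G a k *
      dsum (fun j => (G.gauge (fun i => F.rank i j) k).val)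
        (fun j => (1 : Matrix (Fin (a j)) (Fin (a j)) ℂ)) =
    idMat (∑ i, G.rank k i * ∑ j, F.rank i j * a j) (∑ j, (∑ i, G.rank k i * F.rank i j) * a j) *
      ((G.gauge (fun i => ∑ j, F.rank i j * a j) k).val *
        (dsum (fun i => (1 : Matrix (Fin (G.rank k i)) (Fin (G.rank k i)) ℂ))
          (fun i => (F.gauge a i).val) * permMat (shuffle (G.rank k) F.rank a))) := by
  have h : dsum (fun j => ((G.gauge (fun i => F.rank i j) k)⁻¹).val)
      (fun j => (1 : Matrix (Fin (a j)) (Fin (a j)) ℂ)) *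
      dsum (fun j => (G.gauge (fun i => F.rank i j) k).val)
        (fun j => (1 : Matrix (Fin (a j)) (Fin (a j)) ℂ)) = 1 := by
    rw [dsum_mul]; exact dsum_one_of (by simp) (by simp)
  unfold compGauge
  simp only [Matrix.mul_assoc, h, Matrix.mul_one]

theorem dsum_mul_comp_gauge_inv {n m p : ℕ} (F : Mor n m) (G : Mor m p) (a : Fin n → ℕ)
    (k : Fin p) :
    dsum (fun j => ((G.gauge (fun i => F.rank i j) k)⁻¹).val)
        (fun j => (1 : Matrix (Fin (a j)) (Fin (a j)) ℂ)) * compGaugeInv F G a k =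
    permMat (shuffle (G.rank k) F.rank a).symm *
      (dsum (fun i => (1 : Matrix (Fin (G.rank k i)) (Fin (G.rank k i)) ℂ))
          (fun i => ((F.gauge a i)⁻¹).val) *
        (((G.gauge (fun i => ∑ j, F.rank i j * a j) k)⁻¹).val *
      idMat (∑ j, (∑ i, G.rank k i * F.rank i j) * a j)
        (∑ i, G.rank k i * ∑ j, F.rank i j * a j))) := by
  have h : dsum (fun j => ((G.gauge (fun i => F.rank i j) k)⁻¹).val)
      (fun j => (1 : Matrix (Fin (a j)) (Fin (a j)) ℂ)) *
      dsum (fun j => (G.gauge (fun i => F.rank i j) k).val)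
        (fun j => (1 : Matrix (Fin (a j)) (Fin (a j)) ℂ)) = 1 := by
    rw [dsum_mul]; exact dsum_one_of (by simp) (by simp)
  unfold compGaugeInv
  simp only [← Matrix.mul_assoc, h, Matrix.one_mul]

end Mor

/-- A 2-morphism `(R, s) ⟶ (R', s')` of 2-matrices: a matrix whose `(i, j)` entry is a complex
`R' i j × R i j` matrix. -/
@[ext]
structure Cell {n m : ℕ} (F G : Mor n m) where
  /-- The entries. -/
  entry (i : Fin m) (j : Fin n) : Matrix (Fin (G.rank i j)) (Fin (F.rank i j)) ℂ

/-- The 1-morphisms `n ⟶ m` and their 2-morphisms; vertical composition is entrywise. -/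
instance {n m : ℕ} : Category (Mor n m) where
  Hom := Cell
  id F := ⟨fun _ _ => 1⟩
  comp S T := ⟨fun i j => T.entry i j * S.entry i j⟩
  id_comp _ := by ext : 3; simp
  comp_id _ := by ext : 3; simp
  assoc _ _ _ := by ext : 3; simp [Matrix.mul_assoc]

namespace Cell

@[ext]
theorem hom_ext {n m : ℕ} {F G : Mor n m} {S T : F ⟶ G} (h : ∀ i j, Cell.entry S i j = Cell.entry T i j) : S = T :=
  Cell.ext (funext₂ h)

@[simp] theorem id_entry {n m : ℕ} (F : Mor n m) (i : Fin m) (j : Fin n) :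
    Cell.entry (𝟙 F) i j = 1 := rfl

@[simp] theorem comp_entry {n m : ℕ} {F G H : Mor n m} (S : F ⟶ G) (T : G ⟶ H) (i : Fin m)
    (j : Fin n) : Cell.entry (S ≫ T) i j = Cell.entry T i j * Cell.entry S i j := rfl

/-- The horizontal composite of `S : F ⟶ F'` and `T : G ⟶ G'`, with entries
`s' k (R'(e j)) * (⨁ i, T k i ⊗ S i j) * (s k (R(e j)))⁻¹`, where `s`, `s'` are the gauges of
`G`, `G'` and `R`, `R'` are the rank matrices of `F`, `F'`. -/
def hcomp {n m p : ℕ} {F F' : Mor n m} {G G' : Mor m p} (S : F ⟶ F') (T : G ⟶ G') :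
    F.comp G ⟶ F'.comp G' where
  entry k j := (G'.gauge (fun i => F'.rank i j) k).val *
    (dsum (fun i => Cell.entry T k i) (fun i => Cell.entry S i j) *
      ((G.gauge (fun i => F.rank i j) k)⁻¹).val)

/-- Between 1-morphisms with equal rank matrices, the 2-morphism whose entries are identity
matrices. -/
def ofRankEq {n m : ℕ} (F G : Mor n m) (h : F.rank = G.rank) : F ≅ G where
  hom := ⟨fun i j => idMat (F.rank i j) (G.rank i j)⟩
  inv := ⟨fun i j => idMat (G.rank i j) (F.rank i j)⟩
  hom_inv_id := by
    exact Cell.ext (funext₂ fun i j => idMat_mul_idMat (congrFun₂ h i j))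
  inv_hom_id := by
    exact Cell.ext (funext₂ fun i j => idMat_mul_idMat (congrFun₂ h i j).symm)

theorem hcomp_id {n m p : ℕ} (F : Mor n m) (G : Mor m p) : hcomp (𝟙 F) (𝟙 G) = 𝟙 (F.comp G) := by
  refine hom_ext fun k j => ?_
  have h : dsum (fun i => Cell.entry (𝟙 G) k i) (fun i => Cell.entry (𝟙 F) i j) = 1 :=
    dsum_one_of (fun _ => rfl) (fun _ => rfl)
  simp only [hcomp, h, Matrix.one_mul]
  exact Units.mul_inv _

theorem hcomp_comp {n m p : ℕ} {F F' F'' : Mor n m} {G G' G'' : Mor m p} (S : F ⟶ F')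
    (S' : F' ⟶ F'') (T : G ⟶ G') (T' : G' ⟶ G'') :
    hcomp (S ≫ S') (T ≫ T') = hcomp S T ≫ hcomp S' T' := by
  refine hom_ext fun k j => ?_
  change (G''.gauge (fun i => F''.rank i j) k).val *
    (dsum (fun i => Cell.entry T' k i * Cell.entry T k i)
      (fun i => Cell.entry S' i j * Cell.entry S i j) *
      ((G.gauge (fun i => F.rank i j) k)⁻¹).val) =
    ((G''.gauge (fun i => F''.rank i j) k).val *
      (dsum (fun i => Cell.entry T' k i) (fun i => Cell.entry S' i j) *
        ((G'.gauge (fun i => F'.rank i j) k)⁻¹).val)) *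
    ((G'.gauge (fun i => F'.rank i j) k).val *
      (dsum (fun i => Cell.entry T k i) (fun i => Cell.entry S i j) *
        ((G.gauge (fun i => F.rank i j) k)⁻¹).val))
  have h : ((G'.gauge (fun i => F'.rank i j) k)⁻¹).val *
    (G'.gauge (fun i => F'.rank i j) k).val = 1 := Units.inv_mul _
  rw [← dsum_mul]
  simp only [Matrix.mul_assoc]
  rw [← Matrix.mul_assoc _ (G'.gauge (fun i => F'.rank i j) k).val, h, Matrix.one_mul]

theorem hcomp_assoc {n m p q : ℕ} {F F' : Mor n m} {G G' : Mor m p} {H H' : Mor p q} (S : F ⟶ F')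
    (T : G ⟶ G') (U : H ⟶ H') (h : (F.comp (G.comp H)).rank = ((F.comp G).comp H).rank)
    (h' : ((F'.comp G').comp H').rank = (F'.comp (G'.comp H')).rank) :
    hcomp S (hcomp T U) = (ofRankEq (F.comp (G.comp H)) ((F.comp G).comp H) h).hom ≫
      hcomp (hcomp S T) U ≫ (ofRankEq ((F'.comp G').comp H') (F'.comp (G'.comp H')) h').hom := by
  refine hom_ext fun k j => ?_
  change Mor.compGauge G' H' (fun i => F'.rank i j) k *
      (dsum (fun i => (H'.gauge (fun l => G'.rank l i) k).val *
          (dsum (fun l => Cell.entry U k l) (fun l => Cell.entry T l i) *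
            ((H.gauge (fun l => G.rank l i) k)⁻¹).val))
        (fun i => Cell.entry S i j) *
      Mor.compGaugeInv G H (fun i => F.rank i j) k) =
    (idMat (∑ l, H'.rank k l * ∑ i, G'.rank l i * F'.rank i j)
        (∑ i, (∑ l, H'.rank k l * G'.rank l i) * F'.rank i j) *
      ((H'.gauge (fun l => ∑ i, G'.rank l i * F'.rank i j) k).val *
        (dsum (fun l => Cell.entry U k l)
          (fun l => (G'.gauge (fun i => F'.rank i j) l).val *
            (dsum (fun i => Cell.entry T l i) (fun i => Cell.entry S i j) *
              ((G.gauge (fun i => F.rank i j) l)⁻¹).val)) *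
          ((H.gauge (fun l => ∑ i, G.rank l i * F.rank i j) k)⁻¹).val))) *
      idMat (∑ i, (∑ l, H.rank k l * G.rank l i) * F.rank i j)
        (∑ l, H.rank k l * ∑ i, G.rank l i * F.rank i j)
  have e1 : dsum (fun i => (H'.gauge (fun l => G'.rank l i) k).val *
          (dsum (fun l => Cell.entry U k l) (fun l => Cell.entry T l i) *
            ((H.gauge (fun l => G.rank l i) k)⁻¹).val))
        (fun i => Cell.entry S i j) =
      dsum (fun i => (H'.gauge (fun l => G'.rank l i) k).val)
        (fun i => (1 : Matrix (Fin (F'.rank i j)) (Fin (F'.rank i j)) ℂ)) *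
      (dsum (fun i => dsum (fun l => Cell.entry U k l) (fun l => Cell.entry T l i))
        (fun i => Cell.entry S i j) *
      dsum (fun i => ((H.gauge (fun l => G.rank l i) k)⁻¹).val)
        (fun i => (1 : Matrix (Fin (F.rank i j)) (Fin (F.rank i j)) ℂ))) := by
    rw [dsum_mul, dsum_mul]; simp only [Matrix.one_mul, Matrix.mul_one]
  have e2 : dsum (fun l => Cell.entry U k l)
          (fun l => (G'.gauge (fun i => F'.rank i j) l).val *
            (dsum (fun i => Cell.entry T l i) (fun i => Cell.entry S i j) *
              ((G.gauge (fun i => F.rank i j) l)⁻¹).val)) =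
      dsum (fun l => (1 : Matrix (Fin (H'.rank k l)) (Fin (H'.rank k l)) ℂ))
        (fun l => (G'.gauge (fun i => F'.rank i j) l).val) *
      (dsum (fun l => Cell.entry U k l)
        (fun l => dsum (fun i => Cell.entry T l i) (fun i => Cell.entry S i j)) *
      dsum (fun l => (1 : Matrix (Fin (H.rank k l)) (Fin (H.rank k l)) ℂ))
        (fun l => ((G.gauge (fun i => F.rank i j) l)⁻¹).val)) := by
    rw [dsum_mul, dsum_mul]; simp only [Matrix.one_mul, Matrix.mul_one]
  have e3 := permMat_shuffle_mul (fun l => Cell.entry U k l) (fun l i => Cell.entry T l i)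
    (fun i => Cell.entry S i j)
  have e4 := permMat_mul_symm (shuffle (H.rank k) G.rank (fun i => F.rank i j))
  rw [e1, e2]
  simp only [Matrix.mul_assoc]
  rw [Mor.dsum_mul_comp_gauge_inv, ← Matrix.mul_assoc (Mor.compGauge _ _ _ _),
    Mor.comp_gauge_mul_dsum]
  simp only [Matrix.mul_assoc]
  rw [← Matrix.mul_assoc (permMat _) (dsum _ _), e3]
  simp only [Matrix.mul_assoc]
  rw [← Matrix.mul_assoc (permMat _) (permMat _), e4, Matrix.one_mul]

theorem hcomp_unit_left {n m : ℕ} {G G' : Mor n m} (T : G ⟶ G')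
    (h : ((Mor.id n).comp G).rank = G.rank) (h' : G'.rank = ((Mor.id n).comp G').rank) :
    hcomp (𝟙 (Mor.id n)) T = (ofRankEq _ _ h).hom ≫ T ≫ (ofRankEq _ _ h').hom := by
  refine hom_ext fun k j => ?_
  change (G'.gauge (fun i => (Mor.id n).rank i j) k).val *
    (dsum (fun i => Cell.entry T k i)
        (fun i => (1 : Matrix (Fin ((Mor.id n).rank i j)) (Fin ((Mor.id n).rank i j)) ℂ)) *
      ((G.gauge (fun i => (Mor.id n).rank i j) k)⁻¹).val) =
    (idMat (G'.rank k j) (∑ i, G'.rank k i * (Mor.id n).rank i j) * Cell.entry T k j) *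
      idMat (∑ i, G.rank k i * (Mor.id n).rank i j) (G.rank k j)
  rw [G'.gauge_unit j (a := fun i => (Mor.id n).rank i j) (fun _ => rfl),
    G.gauge_unit j (a := fun i => (Mor.id n).rank i j) (fun _ => rfl),
    dsum_unit_right _ j (a := fun i => (Mor.id n).rank i j) (fun _ => rfl)]
  simp only [inv_one, Units.val_one, Matrix.one_mul, Matrix.mul_one]

theorem hcomp_unit_right {n m : ℕ} {F F' : Mor n m} (S : F ⟶ F')
    (h : (F.comp (Mor.id m)).rank = F.rank) (h' : F'.rank = (F'.comp (Mor.id m)).rank) :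
    hcomp S (𝟙 (Mor.id m)) = (ofRankEq _ _ h).hom ≫ S ≫ (ofRankEq _ _ h').hom := by
  refine hom_ext fun k j => ?_
  have e := dsum_unit_left (fun i => Cell.entry S i j) k
    (t := fun i => (Mor.id m).rank k i) (fun i => by simp only [Mor.id, Mor.ofRank_rank, eq_comm])
  change (1 : Matrix (Fin (∑ i, (Mor.id m).rank k i * F'.rank i j))
      (Fin (∑ i, (Mor.id m).rank k i * F'.rank i j)) ℂ) *
    (dsum (fun i => (1 : Matrix (Fin ((Mor.id m).rank k i)) (Fin ((Mor.id m).rank k i)) ℂ))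
        (fun i => Cell.entry S i j) *
      (1 : Matrix (Fin (∑ i, (Mor.id m).rank k i * F.rank i j))
        (Fin (∑ i, (Mor.id m).rank k i * F.rank i j)) ℂ)) =
    (idMat (F'.rank k j) (∑ i, (Mor.id m).rank k i * F'.rank i j) * Cell.entry S k j) *
      idMat (∑ i, (Mor.id m).rank k i * F.rank i j) (F.rank k j)
  rw [Matrix.one_mul, Matrix.mul_one, e]

theorem ofRankEq_refl {n m : ℕ} (F : Mor n m) : (ofRankEq F F rfl).hom = 𝟙 F :=
  hom_ext fun _ _ => idMat_self _

theorem ofRankEq_comp {n m : ℕ} {F G H : Mor n m} (h : F.rank = G.rank) (h' : G.rank = H.rank) :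
    (ofRankEq F G h).hom ≫ (ofRankEq G H h').hom = (ofRankEq F H (h.trans h')).hom :=
  hom_ext fun i j => idMat_mul (congrFun₂ h i j)

theorem hcomp_ofRankEq_of_eq {n m p : ℕ} {F F' : Mor n m} {G G' : Mor m p} (hF : F = F')
    (hG : G = G') (h : F.rank = F'.rank) (h' : G.rank = G'.rank)
    (h'' : (F.comp G).rank = (F'.comp G').rank) :
    hcomp (ofRankEq F F' h).hom (ofRankEq G G' h').hom = (ofRankEq _ _ h'').hom := by
  subst hF hG
  rw [ofRankEq_refl, ofRankEq_refl, ofRankEq_refl, hcomp_id]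

end Cell

namespace Mor

theorem ext_of_gauge {n m : ℕ} {F G : Mor n m} (h : F.rank = G.rank)
    (h' : ∀ a i, (F.gauge a i).val =
      (idMat (∑ j, G.rank i j * a j) (∑ j, F.rank i j * a j) * (G.gauge a i).val *
        idMat (∑ j, F.rank i j * a j) (∑ j, G.rank i j * a j))) : F = G := by
  cases F; cases G
  subst h
  congr
  funext a i
  simpa only [idMat_self, Matrix.one_mul, Matrix.mul_one, Units.ext_iff] using h' a i

theorem id_comp {n m : ℕ} (G : Mor n m) : (Mor.id n).comp G = G := by
  have h : ((Mor.id n).comp G).rank = G.rank := by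
    funext k j; exact sum_mul_unit _ j (fun _ => rfl)
  have ha : ∀ a : Fin n → ℕ, (fun i => ∑ j, (Mor.id n).rank i j * a j) = a := fun a => by
    funext i; simp [Mor.id]
  refine ext_of_gauge h fun a k => ?_
  change compGauge (Mor.id n) G a k =
    idMat (∑ j, G.rank k j * a j) (∑ j, (∑ i, G.rank k i * (Mor.id n).rank i j) * a j) *
      (G.gauge a k).val *
        idMat (∑ j, (∑ i, G.rank k i * (Mor.id n).rank i j) * a j) (∑ j, G.rank k j * a j)
  have h1 : dsum (fun i => (1 : Matrix (Fin (G.rank k i)) (Fin (G.rank k i)) ℂ))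
      (fun i => ((Mor.id n).gauge a i).val) = 1 := dsum_one_of (fun _ => rfl) (fun _ => rfl)
  have h2 : dsum (fun j => ((G.gauge (fun i => (Mor.id n).rank i j) k)⁻¹).val)
      (fun j => (1 : Matrix (Fin (a j)) (Fin (a j)) ℂ)) = 1 :=
    dsum_one_of (fun j => by
      rw [G.gauge_unit j (a := fun i => (Mor.id n).rank i j) (fun _ => rfl)]; simp) (fun _ => rfl)
  have h3 : permMat (shuffle (G.rank k) (Mor.id n).rank a) =
      idMat (∑ j, (∑ i, G.rank k i * (Mor.id n).rank i j) * a j)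
        (∑ i, G.rank k i * ∑ j, (Mor.id n).rank i j * a j) := permMat_shuffle_id (G.rank k) a
  unfold compGauge
  rw [h1, h2, h3, G.gauge_congr (ha a), Matrix.one_mul, Matrix.mul_one]
  simp only [← Matrix.mul_assoc]
  rw [idMat_mul (Finset.sum_congr rfl fun i _ => by rw [congrFun (ha a) i])]
  simp only [Matrix.mul_assoc]
  congr 2
  exact idMat_mul (act_act _ _ _).symm

theorem comp_id {n m : ℕ} (F : Mor n m) : F.comp (Mor.id m) = F := by
  have hk : ∀ k i, (Mor.id m).rank k i = if i = k then 1 else 0 := fun k i => by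
    simp only [Mor.id, Mor.ofRank_rank, eq_comm]
  have h : (F.comp (Mor.id m)).rank = F.rank := by
    funext k j; exact sum_unit_mul _ k (hk k)
  refine ext_of_gauge h fun a k => ?_
  change compGauge F (Mor.id m) a k =
    idMat (∑ j, F.rank k j * a j) (∑ j, (∑ i, (Mor.id m).rank k i * F.rank i j) * a j) *
      (F.gauge a k).val *
        idMat (∑ j, (∑ i, (Mor.id m).rank k i * F.rank i j) * a j) (∑ j, F.rank k j * a j)
  have h1 : ((Mor.id m).gauge (fun i => ∑ j, F.rank i j * a j) k).val = 1 := rfl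
  have h2 : dsum (fun j => (((Mor.id m).gauge (fun i => F.rank i j) k)⁻¹).val)
      (fun j => (1 : Matrix (Fin (a j)) (Fin (a j)) ℂ)) = 1 :=
    dsum_one_of (fun j => by
      change (((1 : GL _ ℂ)⁻¹).val) = 1; rw [inv_one]; rfl) (fun _ => rfl)
  unfold compGauge
  rw [h1, h2, dsum_unit_left _ k (hk k), permMat_shuffle_unit_left _ _ k (hk k), Matrix.one_mul,
    Matrix.mul_one]
  simp only [← Matrix.mul_assoc]
  rw [idMat_mul (by rw [sum_unit_mul _ k (hk k)])]
  simp only [Matrix.mul_assoc]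
  congr 2
  exact idMat_mul (act_act _ _ _).symm

theorem eq_of_mul_eq {p q s t : ℕ} (h : p = q) {M₂ : Matrix (Fin p) (Fin p) ℂ}
    {M₁ : Matrix (Fin q) (Fin q) ℂ} {X : Matrix (Fin p) (Fin s) ℂ} {Y : Matrix (Fin s) (Fin p) ℂ}
    {K : Matrix (Fin t) (Fin s) ℂ} (hY : X * Y = 1) (h₂ : M₂ * X = idMat t p * K)
    (h₁ : M₁ * (idMat p q * X) = idMat t q * K) : M₂ = idMat q p * M₁ * idMat p q := by
  subst h
  rw [idMat_self, Matrix.one_mul] at *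
  rw [Matrix.mul_one]
  calc M₂ = (M₂ * X) * Y := by rw [Matrix.mul_assoc, hY, Matrix.mul_one]
    _ = (M₁ * X) * Y := by rw [h₂, h₁]
    _ = M₁ := by rw [Matrix.mul_assoc, hY, Matrix.mul_one]

theorem comp_assoc {n m p q : ℕ} (F : Mor n m) (G : Mor m p) (H : Mor p q) :
    (F.comp G).comp H = F.comp (G.comp H) := by
  have h : ((F.comp G).comp H).rank = (F.comp (G.comp H)).rank := by
    funext k j; exact act_act _ _ _
  refine ext_of_gauge h fun a k => ?_
  obtain ⟨M₂, h₂⟩ : ∃ M : Matrix (Fin (∑ j, (∑ l, H.rank k l * ∑ i, G.rank l i * F.rank i j) * a j))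
      (Fin (∑ j, (∑ l, H.rank k l * ∑ i, G.rank l i * F.rank i j) * a j)) ℂ,
      compGauge (F.comp G) H a k = M := ⟨_, rfl⟩
  obtain ⟨M₁, h₁⟩ : ∃ M : Matrix (Fin (∑ j, (∑ i, (∑ l, H.rank k l * G.rank l i) * F.rank i j) * a j))
      (Fin (∑ j, (∑ i, (∑ l, H.rank k l * G.rank l i) * F.rank i j) * a j)) ℂ,
      compGauge F (G.comp H) a k = M := ⟨_, rfl⟩
  have hR : ∑ j, (∑ i, (∑ l, H.rank k l * G.rank l i) * F.rank i j) * a j =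
      ∑ j, (∑ l, H.rank k l * ∑ i, G.rank l i * F.rank i j) * a j := by simp only [act_act]
  suffices hM : M₂ =
      idMat (∑ j, (∑ i, (∑ l, H.rank k l * G.rank l i) * F.rank i j) * a j)
        (∑ j, (∑ l, H.rank k l * ∑ i, G.rank l i * F.rank i j) * a j) * M₁ *
      idMat (∑ j, (∑ l, H.rank k l * ∑ i, G.rank l i * F.rank i j) * a j)
        (∑ j, (∑ i, (∑ l, H.rank k l * G.rank l i) * F.rank i j) * a j) by
    change compGauge (F.comp G) H a k = _
    rw [h₂, hM]
    subst h₁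
    rfl
  have hX : ∃ Y : Matrix (Fin (∑ j, (∑ i, (∑ l, H.rank k l * G.rank l i) * F.rank i j) * a j))
      (Fin (∑ j, (∑ l, H.rank k l * ∑ i, G.rank l i * F.rank i j) * a j)) ℂ, (dsum (fun j => (H.gauge (fun l => ∑ i, G.rank l i * F.rank i j) k).val)
        (fun j => (1 : Matrix (Fin (a j)) (Fin (a j)) ℂ)) *
      (dsum (fun j => dsum (fun l => (1 : Matrix (Fin (H.rank k l)) (Fin (H.rank k l)) ℂ))
          (fun l => (G.gauge (fun i => F.rank i j) l).val))
        (fun j => (1 : Matrix (Fin (a j)) (Fin (a j)) ℂ)) *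
      dsum (fun j => permMat (shuffle (H.rank k) G.rank (fun i => F.rank i j)))
          (fun j => (1 : Matrix (Fin (a j)) (Fin (a j)) ℂ)))) * Y = 1 := by
    refine ⟨(dsum (fun j => permMat (shuffle (H.rank k) G.rank (fun i => F.rank i j)).symm)
          (fun j => (1 : Matrix (Fin (a j)) (Fin (a j)) ℂ)) *
      dsum (fun j => dsum (fun l => (1 : Matrix (Fin (H.rank k l)) (Fin (H.rank k l)) ℂ))
          (fun l => ((G.gauge (fun i => F.rank i j) l)⁻¹).val))
        (fun j => (1 : Matrix (Fin (a j)) (Fin (a j)) ℂ))) *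
      dsum (fun j => ((H.gauge (fun l => ∑ i, G.rank l i * F.rank i j) k)⁻¹).val)
        (fun j => (1 : Matrix (Fin (a j)) (Fin (a j)) ℂ)), ?_⟩
    refine inv_chain ?_ (inv_chain ?_ ?_)
    · rw [dsum_mul]; exact dsum_one_of (by simp) (by simp)
    · rw [dsum_mul]
      refine dsum_one_of (fun j => ?_) (by simp)
      rw [dsum_mul]; exact dsum_one_of (by simp) (by simp)
    · rw [dsum_mul]; exact dsum_one_of (fun j => permMat_mul_symm _) (by simp)
  have A2 : M₂ *
      (dsum (fun j => (H.gauge (fun l => ∑ i, G.rank l i * F.rank i j) k).val)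
        (fun j => (1 : Matrix (Fin (a j)) (Fin (a j)) ℂ)) *
      (dsum (fun j => dsum (fun l => (1 : Matrix (Fin (H.rank k l)) (Fin (H.rank k l)) ℂ))
          (fun l => (G.gauge (fun i => F.rank i j) l).val))
        (fun j => (1 : Matrix (Fin (a j)) (Fin (a j)) ℂ)) *
      dsum (fun j => permMat (shuffle (H.rank k) G.rank (fun i => F.rank i j)))
          (fun j => (1 : Matrix (Fin (a j)) (Fin (a j)) ℂ)))) =
      idMat (∑ l, H.rank k l * ∑ i, G.rank l i * ∑ j, F.rank i j * a j)
        (∑ j, (∑ l, H.rank k l * ∑ i, G.rank l i * F.rank i j) * a j) *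
      ((H.gauge (fun l => ∑ i, G.rank l i * ∑ j, F.rank i j * a j) k).val *
      (dsum (fun l => (1 : Matrix (Fin (H.rank k l)) (Fin (H.rank k l)) ℂ))
        (fun l => (G.gauge (fun i => ∑ j, F.rank i j * a j) l).val) *
      (dsum (fun l => (1 : Matrix (Fin (H.rank k l)) (Fin (H.rank k l)) ℂ))
        (fun l => dsum (fun i => (1 : Matrix (Fin (G.rank l i)) (Fin (G.rank l i)) ℂ))
          (fun i => (F.gauge a i).val)) *
      (permMat (shuffle (H.rank k) G.rank (fun i => ∑ j, F.rank i j * a j)) *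
      permMat (shuffle (fun i => ∑ l, H.rank k l * G.rank l i) F.rank a))))) := by
    have c1 : M₂ *
        dsum (fun j => (H.gauge (fun l => ∑ i, G.rank l i * F.rank i j) k).val)
          (fun j => (1 : Matrix (Fin (a j)) (Fin (a j)) ℂ)) =
        idMat (∑ l, H.rank k l * ∑ j, (∑ i, G.rank l i * F.rank i j) * a j)
          (∑ j, (∑ l, H.rank k l * ∑ i, G.rank l i * F.rank i j) * a j) *
        ((H.gauge (fun l => ∑ j, (∑ i, G.rank l i * F.rank i j) * a j) k).val *
        (dsum (fun l => (1 : Matrix (Fin (H.rank k l)) (Fin (H.rank k l)) ℂ))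
          (fun l => compGauge F G a l) *
          permMat (shuffle (H.rank k) (fun l j => ∑ i, G.rank l i * F.rank i j) a))) :=
      h₂ ▸ comp_gauge_mul_dsum (F.comp G) H a k
    have c2 := permMat_shuffle_mul (fun l => (1 : Matrix (Fin (H.rank k l)) (Fin (H.rank k l)) ℂ))
      (fun l j => (G.gauge (fun i => F.rank i j) l).val)
      (fun j => (1 : Matrix (Fin (a j)) (Fin (a j)) ℂ))
    have c3 : dsum (fun l => (1 : Matrix (Fin (H.rank k l)) (Fin (H.rank k l)) ℂ))
          (fun l => compGauge F G a l) *
        dsum (fun l => (1 : Matrix (Fin (H.rank k l)) (Fin (H.rank k l)) ℂ))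
          (fun l => dsum (fun j => (G.gauge (fun i => F.rank i j) l).val)
            (fun j => (1 : Matrix (Fin (a j)) (Fin (a j)) ℂ))) =
        idMat (∑ l, H.rank k l * ∑ i, G.rank l i * ∑ j, F.rank i j * a j)
          (∑ l, H.rank k l * ∑ j, (∑ i, G.rank l i * F.rank i j) * a j) *
        (dsum (fun l => (1 : Matrix (Fin (H.rank k l)) (Fin (H.rank k l)) ℂ))
          (fun l => (G.gauge (fun i => ∑ j, F.rank i j * a j) l).val) *
        (dsum (fun l => (1 : Matrix (Fin (H.rank k l)) (Fin (H.rank k l)) ℂ))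
          (fun l => dsum (fun i => (1 : Matrix (Fin (G.rank l i)) (Fin (G.rank l i)) ℂ))
            (fun i => (F.gauge a i).val)) *
        dsum (fun l => (1 : Matrix (Fin (H.rank k l)) (Fin (H.rank k l)) ℂ))
          (fun l => permMat (shuffle (G.rank l) F.rank a)))) := by
      rw [← dsum_one_idMat (H.rank k) (funext fun l => act_act _ _ _)]
      simp only [dsum_mul, comp_gauge_mul_dsum, Matrix.mul_one]
    have c4 := permMat_shuffle_coherence (H.rank k) G.rank F.rank a
    have c5 := H.gauge_congr (a := fun l => ∑ j, (∑ i, G.rank l i * F.rank i j) * a j)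
      (b := fun l => ∑ i, G.rank l i * ∑ j, F.rank i j * a j)
      (funext fun l => (act_act _ _ _).symm) k
    have c6 : ∑ l, H.rank k l * ∑ j, (∑ i, G.rank l i * F.rank i j) * a j =
        ∑ l, H.rank k l * ∑ i, G.rank l i * ∑ j, F.rank i j * a j := by
      simp only [act_act]
    rw [← Matrix.mul_assoc M₂, c1]
    simp only [Matrix.mul_assoc]
    rw [← Matrix.mul_assoc (permMat _) (dsum _ _) (dsum _ _), c2]
    simp only [Matrix.mul_assoc]
    rw [← Matrix.mul_assoc (dsum _ _) (dsum _ _), c3]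
    simp only [Matrix.mul_assoc]
    rw [c4, c5]
    simp only [Matrix.mul_assoc]
    rw [← Matrix.mul_assoc (idMat _ _) (idMat _ _) (dsum _ _ * _), idMat_mul_idMat c6.symm,
      Matrix.one_mul, ← Matrix.mul_assoc (idMat _ _) (idMat _ _), idMat_mul c6.symm]
  have A1 : M₁ * (idMat (∑ j, (∑ l, H.rank k l * ∑ i, G.rank l i * F.rank i j) * a j)
        (∑ j, (∑ i, (∑ l, H.rank k l * G.rank l i) * F.rank i j) * a j) *
      (dsum (fun j => (H.gauge (fun l => ∑ i, G.rank l i * F.rank i j) k).val)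
        (fun j => (1 : Matrix (Fin (a j)) (Fin (a j)) ℂ)) *
      (dsum (fun j => dsum (fun l => (1 : Matrix (Fin (H.rank k l)) (Fin (H.rank k l)) ℂ))
          (fun l => (G.gauge (fun i => F.rank i j) l).val))
        (fun j => (1 : Matrix (Fin (a j)) (Fin (a j)) ℂ)) *
      dsum (fun j => permMat (shuffle (H.rank k) G.rank (fun i => F.rank i j)))
          (fun j => (1 : Matrix (Fin (a j)) (Fin (a j)) ℂ))))) =
      idMat (∑ l, H.rank k l * ∑ i, G.rank l i * ∑ j, F.rank i j * a j)
        (∑ j, (∑ i, (∑ l, H.rank k l * G.rank l i) * F.rank i j) * a j) *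
      ((H.gauge (fun l => ∑ i, G.rank l i * ∑ j, F.rank i j * a j) k).val *
      (dsum (fun l => (1 : Matrix (Fin (H.rank k l)) (Fin (H.rank k l)) ℂ))
        (fun l => (G.gauge (fun i => ∑ j, F.rank i j * a j) l).val) *
      (dsum (fun l => (1 : Matrix (Fin (H.rank k l)) (Fin (H.rank k l)) ℂ))
        (fun l => dsum (fun i => (1 : Matrix (Fin (G.rank l i)) (Fin (G.rank l i)) ℂ))
          (fun i => (F.gauge a i).val)) *
      (permMat (shuffle (H.rank k) G.rank (fun i => ∑ j, F.rank i j * a j)) *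
      permMat (shuffle (fun i => ∑ l, H.rank k l * G.rank l i) F.rank a))))) := by
    have d1 : M₁ * dsum (fun j => compGauge G H (fun i => F.rank i j) k)
          (fun j => (1 : Matrix (Fin (a j)) (Fin (a j)) ℂ)) =
        idMat (∑ i, (∑ l, H.rank k l * G.rank l i) * ∑ j, F.rank i j * a j)
          (∑ j, (∑ i, (∑ l, H.rank k l * G.rank l i) * F.rank i j) * a j) *
        (compGauge G H (fun i => ∑ j, F.rank i j * a j) k *
        (dsum (fun i => (1 : Matrix (Fin (∑ l, H.rank k l * G.rank l i))
            (Fin (∑ l, H.rank k l * G.rank l i)) ℂ)) (fun i => (F.gauge a i).val) *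
          permMat (shuffle (fun i => ∑ l, H.rank k l * G.rank l i) F.rank a))) :=
      h₁ ▸ comp_gauge_mul_dsum F (G.comp H) a k
    have d3 : dsum (fun j => compGauge G H (fun i => F.rank i j) k)
          (fun j => (1 : Matrix (Fin (a j)) (Fin (a j)) ℂ)) *
        dsum (fun j => dsum (fun i => (H.gauge (fun l => G.rank l i) k).val)
            (fun i => (1 : Matrix (Fin (F.rank i j)) (Fin (F.rank i j)) ℂ)))
          (fun j => (1 : Matrix (Fin (a j)) (Fin (a j)) ℂ)) =
        idMat (∑ j, (∑ l, H.rank k l * ∑ i, G.rank l i * F.rank i j) * a j)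
          (∑ j, (∑ i, (∑ l, H.rank k l * G.rank l i) * F.rank i j) * a j) *
        (dsum (fun j => (H.gauge (fun l => ∑ i, G.rank l i * F.rank i j) k).val)
          (fun j => (1 : Matrix (Fin (a j)) (Fin (a j)) ℂ)) *
        (dsum (fun j => dsum (fun l => (1 : Matrix (Fin (H.rank k l)) (Fin (H.rank k l)) ℂ))
            (fun l => (G.gauge (fun i => F.rank i j) l).val))
          (fun j => (1 : Matrix (Fin (a j)) (Fin (a j)) ℂ)) *
        dsum (fun j => permMat (shuffle (H.rank k) G.rank (fun i => F.rank i j)))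
            (fun j => (1 : Matrix (Fin (a j)) (Fin (a j)) ℂ)))) := by
      rw [← dsum_idMat_one a (funext fun j => act_act _ _ _)]
      simp only [dsum_mul, comp_gauge_mul_dsum, Matrix.mul_one]
    have d4 := permMat_shuffle_mul (fun i => (H.gauge (fun l => G.rank l i) k).val)
      (fun i j => (1 : Matrix (Fin (F.rank i j)) (Fin (F.rank i j)) ℂ))
      (fun j => (1 : Matrix (Fin (a j)) (Fin (a j)) ℂ))
    have d5 : dsum (fun i => (1 : Matrix (Fin (∑ l, H.rank k l * G.rank l i))
            (Fin (∑ l, H.rank k l * G.rank l i)) ℂ)) (fun i => (F.gauge a i).val) *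
        dsum (fun i => (H.gauge (fun l => G.rank l i) k).val)
          (fun i => dsum (fun j => (1 : Matrix (Fin (F.rank i j)) (Fin (F.rank i j)) ℂ))
            (fun j => (1 : Matrix (Fin (a j)) (Fin (a j)) ℂ))) =
        dsum (fun i => (H.gauge (fun l => G.rank l i) k).val)
          (fun i => (1 : Matrix (Fin (∑ j, F.rank i j * a j)) (Fin (∑ j, F.rank i j * a j)) ℂ)) *
        dsum (fun i => dsum (fun l => (1 : Matrix (Fin (H.rank k l)) (Fin (H.rank k l)) ℂ))
          (fun l => (1 : Matrix (Fin (G.rank l i)) (Fin (G.rank l i)) ℂ)))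
          (fun i => (F.gauge a i).val) := by
      simp only [dsum_mul, dsum_one, Matrix.mul_one, Matrix.one_mul]
    have d6 := permMat_shuffle_mul (fun l => (1 : Matrix (Fin (H.rank k l)) (Fin (H.rank k l)) ℂ))
      (fun l i => (1 : Matrix (Fin (G.rank l i)) (Fin (G.rank l i)) ℂ))
      (fun i => (F.gauge a i).val)
    rw [← d3, ← Matrix.mul_assoc M₁, d1]
    simp only [Matrix.mul_assoc]
    rw [d4, ← Matrix.mul_assoc (dsum _ _) (dsum _ _), d5]
    simp only [Matrix.mul_assoc]
    rw [← Matrix.mul_assoc (compGauge _ _ _ _), comp_gauge_mul_dsum]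
    simp only [Matrix.mul_assoc]
    rw [← Matrix.mul_assoc (permMat _) (dsum _ _), d6]
    simp only [Matrix.mul_assoc]
    rw [← Matrix.mul_assoc (idMat _ _) (idMat _ _), idMat_mul (act_act _ _ _)]
  obtain ⟨Y, hY⟩ := hX
  exact eq_of_mul_eq hR.symm hY A2 A1

end Mor

namespace Cell

theorem hcomp_ofRankEq_right {n m p : ℕ} {F F' : Mor n m} (G : Mor m p) (h : F.rank = F'.rank)
    (h'' : (F.comp G).rank = (F'.comp G).rank) :
    hcomp (ofRankEq F F' h).hom (𝟙 G) = (ofRankEq (F.comp G) (F'.comp G) h'').hom := by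
  obtain ⟨R, s, hs⟩ := F
  obtain ⟨R', s', hs'⟩ := F'
  obtain rfl : R = R' := h
  refine hom_ext fun k j => ?_
  have e : dsum (fun i => (1 : Matrix (Fin (G.rank k i)) (Fin (G.rank k i)) ℂ))
      (fun i => idMat (R i j) (R i j)) = 1 := dsum_one_of (fun _ => rfl) (fun _ => idMat_self _)
  change (G.gauge (fun i => R i j) k).val *
    (dsum (fun i => (1 : Matrix (Fin (G.rank k i)) (Fin (G.rank k i)) ℂ))
      (fun i => idMat (R i j) (R i j)) * ((G.gauge (fun i => R i j) k)⁻¹).val) =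
    idMat (∑ i, G.rank k i * R i j) (∑ i, G.rank k i * R i j)
  rw [e, Matrix.one_mul, idMat_self]
  exact Units.mul_inv _

/-- If the columns of the rank matrix of `F` are standard basis vectors, the gauges do not matter
in left whiskerings with `F`. -/
theorem hcomp_ofRankEq_left {n m p : ℕ} (F : Mor n m) {G G' : Mor m p} (h : G.rank = G'.rank)
    (σ : Fin n → Fin m) (hF : ∀ i j, F.rank i j = if i = σ j then 1 else 0)
    (h'' : (F.comp G).rank = (F.comp G').rank) :
    hcomp (𝟙 F) (ofRankEq G G' h).hom = (ofRankEq (F.comp G) (F.comp G') h'').hom := by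
  obtain ⟨R, s, hs⟩ := G
  obtain ⟨R', s', hs'⟩ := G'
  obtain rfl : R = R' := h
  refine hom_ext fun k j => ?_
  have e : dsum (fun i => idMat (R k i) (R k i))
      (fun i => (1 : Matrix (Fin (F.rank i j)) (Fin (F.rank i j)) ℂ)) = 1 :=
    dsum_one_of (fun _ => idMat_self _) (fun _ => rfl)
  have e₁ := Mor.gauge_unit ⟨R, s, hs⟩ (σ j) (fun i => hF i j) k
  have e₂ := Mor.gauge_unit ⟨R, s', hs'⟩ (σ j) (fun i => hF i j) k
  change (s' (fun i => F.rank i j) k).val *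
    (dsum (fun i => idMat (R k i) (R k i))
      (fun i => (1 : Matrix (Fin (F.rank i j)) (Fin (F.rank i j)) ℂ)) *
      ((s (fun i => F.rank i j) k)⁻¹).val) =
    idMat (∑ i, R k i * F.rank i j) (∑ i, R k i * F.rank i j)
  change s (fun i => F.rank i j) k = 1 at e₁
  change s' (fun i => F.rank i j) k = 1 at e₂
  rw [e, e₁, e₂, idMat_self, inv_one, Matrix.one_mul, Units.val_one, Matrix.one_mul]

theorem hcomp_assoc' {n m p q : ℕ} {F F' : Mor n m} {G G' : Mor m p} {H H' : Mor p q} (S : F ⟶ F')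
    (T : G ⟶ G') (U : H ⟶ H') (h : ((F.comp G).comp H).rank = (F.comp (G.comp H)).rank)
    (h' : (F'.comp (G'.comp H')).rank = ((F'.comp G').comp H').rank) :
    hcomp (hcomp S T) U = (ofRankEq ((F.comp G).comp H) (F.comp (G.comp H)) h).hom ≫
      hcomp S (hcomp T U) ≫ (ofRankEq (F'.comp (G'.comp H')) ((F'.comp G').comp H') h').hom := by
  rw [hcomp_assoc S T U h.symm h'.symm]
  simp only [Category.assoc]
  rw [ofRankEq_comp, ← Category.assoc, ofRankEq_comp, ofRankEq_refl, ofRankEq_refl,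
    Category.id_comp, Category.comp_id]

theorem ofRankEq_inv {n m : ℕ} (F G : Mor n m) (h : F.rank = G.rank) :
    (ofRankEq F G h).inv = (ofRankEq G F h.symm).hom := rfl

theorem ofRankEq_eqToIso {n m : ℕ} {F G : Mor n m} (h : F.rank = G.rank) (h' : F = G) :
    ofRankEq F G h = eqToIso h' := by
  subst h'
  ext1
  exact ofRankEq_refl _

end Cell

end TwoMatrix

open TwoMatrix

/-- The objects of the 2-category of 2-matrices over `ℂ`: natural numbers. -/
structure TwoMat where
  /-- The underlying natural number. -/
  dim : ℕ

namespace TwoMat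

/-- The 2-category of 2-matrices over `ℂ`. -/
instance : Bicategory TwoMat where
  Hom n m := Mor n.dim m.dim
  id n := Mor.id n.dim
  comp F G := F.comp G
  homCategory n m := inferInstanceAs (Category (Mor n.dim m.dim))
  whiskerLeft F _ _ T := Cell.hcomp (𝟙 F) T
  whiskerRight S G := Cell.hcomp S (𝟙 G)
  associator F G H := Cell.ofRankEq _ _ (congrArg Mor.rank (Mor.comp_assoc F G H))
  leftUnitor F := Cell.ofRankEq _ _ (congrArg Mor.rank (Mor.id_comp F))
  rightUnitor F := Cell.ofRankEq _ _ (congrArg Mor.rank (Mor.comp_id F))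
  whiskerLeft_id F G := Cell.hcomp_id F G
  whiskerLeft_comp F _ _ _ T T' := by rw [← Cell.hcomp_comp, Category.comp_id]
  id_whiskerLeft {_ _ G G'} T := Cell.hcomp_unit_left T (congrArg Mor.rank (Mor.id_comp G))
    (congrArg Mor.rank (Mor.id_comp G').symm)
  comp_whiskerLeft F G H H' T := by
    have := Cell.hcomp_assoc' (𝟙 F) (𝟙 G) T (congrArg Mor.rank (Mor.comp_assoc F G H))
      (congrArg Mor.rank (Mor.comp_assoc F G H').symm)
    rwa [Cell.hcomp_id] at this
  id_whiskerRight F G := Cell.hcomp_id F G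
  comp_whiskerRight S S' G := by rw [← Cell.hcomp_comp, Category.comp_id]
  whiskerRight_id {_ _ F F'} S := Cell.hcomp_unit_right S (congrArg Mor.rank (Mor.comp_id F))
    (congrArg Mor.rank (Mor.comp_id F').symm)
  whiskerRight_comp {_ _ _ _ F F'} S G H := by
    have := Cell.hcomp_assoc S (𝟙 G) (𝟙 H) (congrArg Mor.rank (Mor.comp_assoc F G H).symm)
      (congrArg Mor.rank (Mor.comp_assoc F' G H))
    rwa [Cell.hcomp_id] at this
  whisker_assoc F G G' T H := Cell.hcomp_assoc' (𝟙 F) T (𝟙 H)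
    (congrArg Mor.rank (Mor.comp_assoc F G H)) (congrArg Mor.rank (Mor.comp_assoc F G' H).symm)
  whisker_exchange S T := by
    rw [← Cell.hcomp_comp, ← Cell.hcomp_comp]
    simp only [Category.comp_id, Category.id_comp]
  pentagon F G H K := by
    rw [← Cell.ofRankEq_refl K, ← Cell.ofRankEq_refl F,
      Cell.hcomp_ofRankEq_of_eq (Mor.comp_assoc F G H) rfl _ _
        (by rw [Mor.comp_assoc F G H]),
      Cell.hcomp_ofRankEq_of_eq rfl (Mor.comp_assoc G H K) _ _
        (by rw [Mor.comp_assoc G H K])]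
    exact (congrArg _ (Cell.ofRankEq_comp _ _)).trans ((Cell.ofRankEq_comp _ _).trans
      (Cell.ofRankEq_comp _ _).symm)
  triangle F G := by
    rw [← Cell.ofRankEq_refl G, ← Cell.ofRankEq_refl F,
      Cell.hcomp_ofRankEq_of_eq rfl (Mor.id_comp G) _ _ (by rw [Mor.id_comp G]),
      Cell.hcomp_ofRankEq_of_eq (Mor.comp_id F) rfl _ _ (by rw [Mor.comp_id F])]
    exact Cell.ofRankEq_comp _ _

/-- The 2-category of 2-matrices is strict. -/
theorem strict : Bicategory.Strict TwoMat where
  id_comp {n m} F := Mor.id_comp (n := n.dim) (m := m.dim) F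
  comp_id {n m} F := Mor.comp_id (n := n.dim) (m := m.dim) F
  assoc {n m p q} F G H := Mor.comp_assoc (n := n.dim) (m := m.dim) (p := p.dim) (q := q.dim) F G H
  leftUnitor_eqToIso {n m} F :=
    Cell.ofRankEq_eqToIso _ (Mor.id_comp (n := n.dim) (m := m.dim) F)
  rightUnitor_eqToIso {n m} F :=
    Cell.ofRankEq_eqToIso _ (Mor.comp_id (n := n.dim) (m := m.dim) F)
  associator_eqToIso {n m p q} F G H := Cell.ofRankEq_eqToIso _
    (Mor.comp_assoc (n := n.dim) (m := m.dim) (p := p.dim) (q := q.dim) F G H)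

end TwoMat

namespace TwoMat

/-- The rank matrix of a 1-morphism. -/
def rank {n m : TwoMat} (F : n ⟶ m) : Fin m.dim → Fin n.dim → ℕ := Mor.rank F

/-- The 1-morphism with a given rank matrix and with trivial gauge. -/
def ofRank {n m : TwoMat} (R : Fin m.dim → Fin n.dim → ℕ) : n ⟶ m := Mor.ofRank R

/-- Between 1-morphisms with equal rank matrices, the 2-morphism whose entries are identity
matrices. -/
def isoOfRankEq {n m : TwoMat} (F G : n ⟶ m) (h : rank F = rank G) : F ≅ G :=
  Cell.ofRankEq F G h

@[simp]
theorem rank_ofRank {n m : TwoMat} (R : Fin m.dim → Fin n.dim → ℕ) :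
    rank (ofRank (n := n) (m := m) R) = R := rfl

@[simp]
theorem rank_id (n : TwoMat) : rank (𝟙 n) = fun i j => if i = j then 1 else 0 := rfl

theorem rank_comp {n m p : TwoMat} (F : n ⟶ m) (G : m ⟶ p) (k : Fin p.dim) (j : Fin n.dim) :
    rank (F ≫ G) k j = ∑ i, rank G k i * rank F i j := rfl

/-- The rank matrix of a map `σ : {1, …, n} → {1, …, m}`. -/
def mapRank {n m : ℕ} (σ : Fin n → Fin m) : Fin m → Fin n → ℕ :=
  fun i j => if i = σ j then 1 else 0

theorem rank_comp_mapRank {n m p : TwoMat} {F : n ⟶ m} {G : m ⟶ p}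
    {σ : Fin n.dim → Fin m.dim} {τ : Fin m.dim → Fin p.dim} (hF : rank F = mapRank σ)
    (hG : rank G = mapRank τ) : rank (F ≫ G) = mapRank (τ ∘ σ) := by
  funext k j
  simp [rank_comp, hF, hG, mapRank]

/-- The condition that all entries of a 2-morphism are identity matrices. -/
def HasIdEntries {n m : TwoMat} {F G : n ⟶ m} (T : F ⟶ G) : Prop :=
  ∃ h : rank F = rank G, T = (isoOfRankEq F G h).hom

namespace HasIdEntries

theorem eq {n m : TwoMat} {F G : n ⟶ m} {T T' : F ⟶ G} (h : HasIdEntries T)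
    (h' : HasIdEntries T') : T = T' := by
  obtain ⟨_, rfl⟩ := h
  obtain ⟨_, rfl⟩ := h'
  rfl

theorem hom {n m : TwoMat} {F G : n ⟶ m} (h : rank F = rank G) :
    HasIdEntries (isoOfRankEq F G h).hom := ⟨h, rfl⟩

theorem inv {n m : TwoMat} {F G : n ⟶ m} (h : rank F = rank G) :
    HasIdEntries (isoOfRankEq F G h).inv := ⟨h.symm, rfl⟩

theorem id {n m : TwoMat} (F : n ⟶ m) : HasIdEntries (𝟙 F) := ⟨rfl, (Cell.ofRankEq_refl F).symm⟩

theorem comp {n m : TwoMat} {F G H : n ⟶ m} {T : F ⟶ G} {T' : G ⟶ H} (h : HasIdEntries T)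
    (h' : HasIdEntries T') : HasIdEntries (T ≫ T') := by
  obtain ⟨h, rfl⟩ := h
  obtain ⟨h', rfl⟩ := h'
  exact ⟨h.trans h', Cell.ofRankEq_comp h h'⟩

theorem whiskerRight {n m p : TwoMat} {F F' : n ⟶ m} {T : F ⟶ F'} (h : HasIdEntries T)
    (G : m ⟶ p) : HasIdEntries (T ▷ G) := by
  obtain ⟨h, rfl⟩ := h
  exact ⟨by funext k j; simp only [rank_comp, h], Cell.hcomp_ofRankEq_right G h _⟩

/-- In left whiskerings with the 1-morphism of a map, gauges do not matter. -/
theorem whiskerLeft {n m p : TwoMat} (σ : Fin n.dim → Fin m.dim) {G G' : m ⟶ p} {T : G ⟶ G'}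
    (h : HasIdEntries T) : HasIdEntries (ofRank (n := n) (mapRank σ) ◁ T) := by
  obtain ⟨h, rfl⟩ := h
  exact ⟨by funext k j; simp only [rank_comp, h],
    Cell.hcomp_ofRankEq_left (ofRank (n := n) (mapRank σ)) h σ (fun _ _ => rfl) _⟩

theorem associator_hom {n m p q : TwoMat} (F : n ⟶ m) (G : m ⟶ p) (H : p ⟶ q) :
    HasIdEntries (α_ F G H).hom := ⟨_, rfl⟩

theorem associator_inv {n m p q : TwoMat} (F : n ⟶ m) (G : m ⟶ p) (H : p ⟶ q) :
    HasIdEntries (α_ F G H).inv := inv (F := (F ≫ G) ≫ H) (G := F ≫ G ≫ H) _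

theorem leftUnitor_hom {n m : TwoMat} (F : n ⟶ m) :
    HasIdEntries (Bicategory.leftUnitor F).hom := ⟨_, rfl⟩

theorem leftUnitor_inv {n m : TwoMat} (F : n ⟶ m) :
    HasIdEntries (Bicategory.leftUnitor F).inv := inv (F := 𝟙 n ≫ F) (G := F) _

theorem rightUnitor_hom {n m : TwoMat} (F : n ⟶ m) :
    HasIdEntries (Bicategory.rightUnitor F).hom := ⟨_, rfl⟩

theorem rightUnitor_inv {n m : TwoMat} (F : n ⟶ m) :
    HasIdEntries (Bicategory.rightUnitor F).inv := inv (F := F ≫ 𝟙 m) (G := F) _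

end HasIdEntries

end TwoMat

/-- A 2-group: a monoidal groupoid in which every object is invertible up to isomorphism. -/
class TwoGroup (G : Type u) [Category.{v} G] [MonoidalCategory G] : Prop extends IsGroupoid G where
  /-- Every object is weakly invertible. -/
  exists_inv (A : G) : ∃ B : G, Nonempty (A ⊗ B ≅ 𝟙_ G) ∧ Nonempty (B ⊗ A ≅ 𝟙_ G)

/-- The isomorphism classes of objects of `G`. -/
def Pi0 (G : Type u) [Category.{v} G] : Type u := Quotient (isIsomorphicSetoid G)

namespace Pi0

/-- The isomorphism class of an object. -/
def mk {G : Type u} [Category.{v} G] (A : G) : Pi0 G := Quotient.mk (isIsomorphicSetoid G) A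

theorem mk_eq {G : Type u} [Category.{v} G] {A B : G} (e : A ≅ B) : mk A = mk B :=
  Quotient.sound ⟨e⟩

variable {G : Type u} [Category.{v} G] [MonoidalCategory G]

/-- The multiplication is induced by the tensor product. -/
instance : Monoid (Pi0 G) where
  mul := Quotient.map₂ (· ⊗ ·) fun _ _ ⟨e⟩ _ _ ⟨e'⟩ => ⟨MonoidalCategory.tensorIso e e'⟩
  one := mk (𝟙_ G)
  mul_assoc := by rintro ⟨A⟩ ⟨B⟩ ⟨C⟩; exact mk_eq (MonoidalCategory.associator A B C)
  one_mul := by rintro ⟨A⟩; exact mk_eq (MonoidalCategory.leftUnitor A)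
  mul_one := by rintro ⟨A⟩; exact mk_eq (MonoidalCategory.rightUnitor A)

theorem mk_tensor (A B : G) : mk (A ⊗ B) = mk A * mk B := rfl

theorem mk_unit : mk (𝟙_ G) = 1 := rfl

theorem exists_mul_eq_one [TwoGroup G] (a : Pi0 G) : ∃ b : Pi0 G, b * a = 1 := by
  obtain ⟨A⟩ := a
  obtain ⟨B, -, ⟨e⟩⟩ := TwoGroup.exists_inv A
  exact ⟨mk B, mk_eq e⟩

/-- The first homotopy group of a 2-group. -/
instance [TwoGroup G] : Group (Pi0 G) :=
  { (inferInstance : Monoid (Pi0 G)) with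
    inv := fun a => (exists_mul_eq_one a).choose
    inv_mul_cancel := fun a => (exists_mul_eq_one a).choose_spec }

end Pi0

open TwoMat

/-- The one-object bicategory of a 2-group (or monoidal category): its 1-morphisms are the objects
of `G`, with composition `B ∘ A = B ⊗ A`. The composite `A ≫ B` of Mathlib is `B ∘ A`, whence the
monoidal opposite. -/
abbrev Deloop (G : Type u) [Category.{v} G] [MonoidalCategory G] := MonoidalSingleObj Gᴹᵒᵖ

/-- The bicategory of representations of `G` on 2-matrices: pseudofunctors, pseudonatural
transformations and modifications. -/
abbrev Rep2Mat (G : Type u) [Category.{v} G] [MonoidalCategory G] := Deloop G ⥤ᵖ TwoMat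

namespace Deloop

variable {G : Type u} [Category.{v} G] [MonoidalCategory G]

/-- The isomorphism class of the object given by a 1-morphism. -/
def cls {x y : Deloop G} (A : x ⟶ y) : Pi0 G := Pi0.mk (show Gᴹᵒᵖ from A).unmop

theorem cls_comp {x y z : Deloop G} (A : x ⟶ y) (B : y ⟶ z) : cls (A ≫ B) = cls B * cls A := rfl

theorem cls_id (x : Deloop G) : cls (𝟙 x) = 1 := rfl

theorem cls_eq [TwoGroup G] {x y : Deloop G} {A B : x ⟶ y} (η : A ⟶ B) : cls A = cls B :=
  Pi0.mk_eq (asIso (show (show Gᴹᵒᵖ from A) ⟶ (show Gᴹᵒᵖ from B) from η).unmop)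

end Deloop

variable {G : Type u} [Category.{v} G] [MonoidalCategory G] [TwoGroup G]

theorem rank_cls_eq {n : ℕ} (ρ : Pi0 G →* Equiv.Perm (Fin n)) {x y : Deloop G} {A B : x ⟶ y}
    (η : A ⟶ B) : rank (ofRank (n := ⟨n⟩) (m := ⟨n⟩) (mapRank (ρ (Deloop.cls A)))) =
      rank (ofRank (n := ⟨n⟩) (m := ⟨n⟩) (mapRank (ρ (Deloop.cls B)))) := by
  rw [Deloop.cls_eq η]

theorem rank_cls_id {n : ℕ} (ρ : Pi0 G →* Equiv.Perm (Fin n)) (x : Deloop G) :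
    rank (ofRank (n := ⟨n⟩) (m := ⟨n⟩) (mapRank (ρ (Deloop.cls (𝟙 x))))) = rank (𝟙 ⟨n⟩) := by
  rw [rank_ofRank, Deloop.cls_id, map_one]; rfl

theorem rank_cls_comp {n : ℕ} (ρ : Pi0 G →* Equiv.Perm (Fin n)) {x y z : Deloop G} (A : x ⟶ y)
    (B : y ⟶ z) : rank (ofRank (n := ⟨n⟩) (m := ⟨n⟩) (mapRank (ρ (Deloop.cls (A ≫ B))))) =
      rank (ofRank (n := ⟨n⟩) (m := ⟨n⟩) (mapRank (ρ (Deloop.cls A))) ≫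
        ofRank (m := ⟨n⟩) (mapRank (ρ (Deloop.cls B)))) := by
  rw [rank_comp_mapRank rfl rfl, rank_ofRank, Deloop.cls_comp, map_mul]; rfl

/-- The purely permutational representation `(n, ρ)`: it maps `A` to the permutation matrix of
`ρ [A]`, with trivial gauge, and all its 2-morphisms have identity matrices as entries. -/
def permRep (n : ℕ) (ρ : Pi0 G →* Equiv.Perm (Fin n)) : Rep2Mat G where
  obj _ := ⟨n⟩
  map A := ofRank (mapRank (ρ (Deloop.cls A)))
  map₂ η := (isoOfRankEq _ _ (rank_cls_eq ρ η)).hom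
  map₂_id A := (HasIdEntries.hom _).eq (.id _)
  map₂_comp η θ := (HasIdEntries.hom _).eq (.comp (.hom _) (.hom _))
  mapId x := isoOfRankEq _ _ (rank_cls_id ρ x)
  mapComp A B := isoOfRankEq _ _ (rank_cls_comp ρ A B)
  map₂_whisker_left A _ _ η :=
    (HasIdEntries.hom _).eq (.comp (.hom _) (.comp (.whiskerLeft _ (.hom _)) (.inv _)))
  map₂_whisker_right η B :=
    (HasIdEntries.hom _).eq (.comp (.hom _) (.comp (.whiskerRight (.hom _) _) (.inv _)))
  map₂_associator A B C :=
    (HasIdEntries.hom _).eq (.comp (.hom _) (.comp (.whiskerRight (.hom _) _)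
      (.comp (.associator_hom _ _ _) (.comp (.whiskerLeft _ (.inv _)) (.inv _)))))
  map₂_left_unitor A :=
    (HasIdEntries.hom _).eq (.comp (.hom _) (.comp (.whiskerRight (.hom _) _) (.leftUnitor_hom _)))
  map₂_right_unitor A :=
    (HasIdEntries.hom _).eq (.comp (.hom _) (.comp (.whiskerLeft _ (.hom _)) (.rightUnitor_hom _)))

theorem permRep_map₂ (n : ℕ) (ρ : Pi0 G →* Equiv.Perm (Fin n)) {x y : Deloop G} {A B : x ⟶ y}
    (η : A ⟶ B) : HasIdEntries ((permRep n ρ).map₂ η) := ⟨rank_cls_eq ρ η, rfl⟩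

theorem permRep_mapId (n : ℕ) (ρ : Pi0 G →* Equiv.Perm (Fin n)) (x : Deloop G) :
    HasIdEntries ((permRep n ρ).mapId x).hom := ⟨rank_cls_id ρ x, rfl⟩

theorem permRep_mapComp (n : ℕ) (ρ : Pi0 G →* Equiv.Perm (Fin n)) {x y z : Deloop G} (A : x ⟶ y)
    (B : y ⟶ z) : HasIdEntries ((permRep n ρ).mapComp A B).hom := ⟨rank_cls_comp ρ A B, rfl⟩

/-- For an equivariant map `f`, the 1-intertwiner `(n, ρ) ⟶ (n', ρ')` given by the rank matrix of
`f`, with trivial gauge, and whose 2-morphisms have identity matrices as entries. -/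
def permIntertwiner {n n' : ℕ} {ρ : Pi0 G →* Equiv.Perm (Fin n)}
    {ρ' : Pi0 G →* Equiv.Perm (Fin n')} (f : Fin n → Fin n')
    (hf : ∀ g i, f (ρ g i) = ρ' g (f i)) : permRep n ρ ⟶ permRep n' ρ' where
  app _ := ofRank (n := ⟨n⟩) (m := ⟨n'⟩) (mapRank f)
  naturality A := isoOfRankEq
    (ofRank (n := ⟨n⟩) (m := ⟨n⟩) (mapRank (ρ (Deloop.cls A))) ≫ ofRank (m := ⟨n'⟩) (mapRank f))
    (ofRank (n := ⟨n⟩) (m := ⟨n'⟩) (mapRank f) ≫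
      ofRank (m := ⟨n'⟩) (mapRank (ρ' (Deloop.cls A)))) (by
    rw [rank_comp_mapRank rfl rfl, rank_comp_mapRank rfl rfl]
    exact congrArg mapRank (funext fun i => hf _ i))
  naturality_naturality η :=
    (HasIdEntries.comp (.whiskerRight (permRep_map₂ n ρ η) _) (.hom _)).eq
      (.comp (.hom _) (.whiskerLeft _ (permRep_map₂ n' ρ' η)))
  naturality_id x :=
    (HasIdEntries.comp (.hom _) (.whiskerLeft _ (permRep_mapId n' ρ' x))).eq
      (.comp (.whiskerRight (permRep_mapId n ρ x) _)
        (.comp (.leftUnitor_hom _) (.rightUnitor_inv _)))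
  naturality_comp A B :=
    (HasIdEntries.comp (.hom _) (.whiskerLeft _ (permRep_mapComp n' ρ' A B))).eq
      (.comp (.whiskerRight (permRep_mapComp n ρ A B) _) (.comp (.associator_hom _ _ _)
        (.comp (.whiskerLeft _ (.hom _)) (.comp (.associator_inv _ _ _)
          (.comp (.whiskerRight (.hom _) _) (.associator_hom _ _ _))))))

/-- The action on the underlying set of a finite `H`-set, by permutations. -/
def actionPerm {H : Type u} [Group H] (X : Action FintypeCat.{w} H) : H →* Equiv.Perm X.V where
  toFun g := FintypeCat.equivEquivIso.symm (X.ρAut g)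
  map_one' := by rw [map_one]; rfl
  map_mul' g h := by rw [map_mul]; rfl

/-- The homomorphism `ρ : H → S_n` of a finite `H`-set with a chosen enumeration. -/
def enumPerm {H : Type u} [Group H] (X : Action FintypeCat.{w} H) {n : ℕ} (e : X.V ≃ Fin n) :
    H →* Equiv.Perm (Fin n) :=
  (e.permCongrHom : Equiv.Perm X.V →* Equiv.Perm (Fin n)).comp (actionPerm X)

theorem enumPerm_apply {H : Type u} [Group H] (X : Action FintypeCat.{w} H) {n : ℕ}
    (e : X.V ≃ Fin n) (h : H) (i : Fin n) : enumPerm X e h i = e ((X.ρAut h).hom (e.symm i)) := rfl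

/-- The map `{1, …, n} → {1, …, n'}` given by an equivariant map of enumerated finite `H`-sets. -/
def enumMap {H : Type u} [Group H] {X Y : Action FintypeCat.{w} H} {n n' : ℕ} (e : X.V ≃ Fin n)
    (e' : Y.V ≃ Fin n') (f : X ⟶ Y) (i : Fin n) : Fin n' := e' (f.hom (e.symm i))

theorem enumMap_equivariant {H : Type u} [Group H] {X Y : Action FintypeCat.{w} H} {n n' : ℕ}
    (e : X.V ≃ Fin n) (e' : Y.V ≃ Fin n') (f : X ⟶ Y) (h : H) (i : Fin n) :
    enumMap e e' f (enumPerm X e h i) = enumPerm Y e' h (enumMap e e' f i) := by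
  simp only [enumMap, enumPerm_apply, Equiv.symm_apply_apply]
  exact congrArg e' (ConcreteCategory.congr_hom (f.comm h) (e.symm i))

/-- For chosen enumerations of all finite sets, the assignments on objects,
`(n, ρ) ↦ permRep n ρ`, and on 1-morphisms, `f ↦ permIntertwiner f`. -/
def permPrefunctor (G : Type u) [Category.{v} G] [MonoidalCategory G] [TwoGroup G]
    (e : ∀ S : FintypeCat.{w}, S ≃ Fin (Nat.card S)) :
    Prefunctor (LocallyDiscrete (Action FintypeCat.{w} (Pi0 G))) (Rep2Mat G) where
  obj X := permRep (Nat.card X.as.V) (enumPerm X.as (e X.as.V))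
  map {X Y} f := permIntertwiner (enumMap (e X.as.V) (e Y.as.V) f.as)
    (enumMap_equivariant (e X.as.V) (e Y.as.V) f.as)

/-- The homotopy category of a bicategory: the same objects, and isomorphism classes of
1-morphisms. -/
structure HoCat (B : Type u) where
  /-- The underlying object. -/
  as : B

namespace HoCat

variable {B : Type u₁} [Bicategory.{w₁, v₁} B] {C : Type u₂} [Bicategory.{w₂, v₂} C]

instance : Category (HoCat B) where
  Hom X Y := Quotient (isIsomorphicSetoid (X.as ⟶ Y.as))
  id X := Quotient.mk _ (𝟙 X.as)
  comp := Quotient.map₂ (· ≫ ·) fun _ g ⟨η⟩ f' _ ⟨θ⟩ =>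
    ⟨Bicategory.whiskerRightIso η f' ≪≫ Bicategory.whiskerLeftIso g θ⟩
  id_comp := by rintro X Y ⟨f⟩; exact Quotient.sound ⟨Bicategory.leftUnitor f⟩
  comp_id := by rintro X Y ⟨f⟩; exact Quotient.sound ⟨Bicategory.rightUnitor f⟩
  assoc := by rintro X Y Z W ⟨f⟩ ⟨g⟩ ⟨h⟩; exact Quotient.sound ⟨Bicategory.associator f g h⟩

/-- The isomorphism class of a 1-morphism. -/
def homMk {X Y : B} (f : X ⟶ Y) : (⟨X⟩ : HoCat B) ⟶ ⟨Y⟩ := Quotient.mk (isIsomorphicSetoid _) f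

/-- The functor between homotopy categories induced by a pseudofunctor. -/
def map (F : B ⥤ᵖ C) : HoCat B ⥤ HoCat C where
  obj X := ⟨F.obj X.as⟩
  map := Quotient.map F.map fun _ _ ⟨η⟩ => ⟨F.map₂Iso η⟩
  map_id X := Quotient.sound ⟨F.mapId X.as⟩
  map_comp := by rintro X Y Z ⟨f⟩ ⟨g⟩; exact Quotient.sound ⟨F.mapComp f g⟩

/-- The isomorphism between a category and the homotopy category of the corresponding locally
discrete bicategory. -/
def ofLocallyDiscrete (D : Type u) [Category.{v} D] : D ⥤ HoCat (LocallyDiscrete D) where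
  obj X := ⟨⟨X⟩⟩
  map f := homMk ⟨f⟩
  map_id _ := rfl
  map_comp _ _ := rfl

end HoCat

end

/-!
The proof rests on two observations.

Between two 1-morphisms of 2-matrices there is at most one 2-morphism all of whose entries are
identity matrices (`HasIdEntries.eq`), and such 2-morphisms are closed under vertical composition,
right whiskering, and left whiskering with the 1-morphism of a map, and they include the structural
isomorphisms of the 2-category. Since every component of an `F f` is the 1-morphism of a map, an
equation between pastings of such 2-morphisms, with left whiskerings of this kind only, holds
automatically. So the pseudofunctor exists as
soon as the rank matrices of the required 2-isomorphisms agree, and these are the matrices of maps,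
with `R(f' ∘ f) = R(f') R(f)` (`permPseudofunctor`). The composition is preserved only up to such
2-isomorphisms because a composite of gauge trivial 1-morphisms need not be gauge trivial.

Isomorphic 1-morphisms have the same rank matrix (`rank_eq_of_iso`), since an invertible complex
matrix is square. Hence an isomorphism `F f ≅ F f'` forces `R(f) = R(f')`, and so `f = f'`, which is
faithfulness. An equivalence between two permutational representations has a rank matrix that is
invertible over `ℕ`, hence the permutation matrix of a bijection (`exists_equiv_rank_eq`). Its
naturality 2-isomorphisms show that this matrix intertwines the permutation matrices of the two
actions, so the bijection is equivariant (`exists_equivariant_equiv`), which gives essential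
injectivity. No cocycle has to be examined, since only rank matrices are compared.

The last assertion holds for any faithful and essentially injective functor: its source is
equivalent to a subcategory of its target (`exists_equivalence_wideSubcategory`).
-/

/-! ### Subcategories from faithful functors that reflect isomorphism of objects -/

section Subcategory

variable {C : Type u₁} [Category.{v₁} C] {D : Type u₂} [Category.{v₂} D]

/-- The morphisms of a subcategory of `D` on the essential image of `F`. For each object `Z` of the
essential image, an object `X` and an isomorphism `F.obj X ≅ Z` are chosen; a morphism `Z ⟶ Z'`
belongs to the subcategory if conjugation with these isomorphisms turns it into the image of a
morphism `X ⟶ X'`. The choice makes these morphisms closed under composition. -/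
def imageMorphisms (F : C ⥤ D) : MorphismProperty F.essImage.FullSubcategory := fun Z Z' f =>
  ∃ g : Z.property.witness ⟶ Z'.property.witness,
    F.map g = Z.property.getIso.hom ≫ f.hom ≫ Z'.property.getIso.inv

instance (F : C ⥤ D) : (imageMorphisms F).IsMultiplicative where
  id_mem Z := ⟨𝟙 _, by simp⟩
  comp_mem f f' := by
    rintro ⟨g, hg⟩ ⟨g', hg'⟩
    exact ⟨g ≫ g', by simp [hg, hg']⟩

/-- For a faithful functor `F : C ⥤ D`, the functor from the subcategory of `D` with morphisms
`imageMorphisms F` to `C`, given by the chosen preimages of objects and by the unique preimages of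
morphisms. -/
noncomputable def imageFunctor (F : C ⥤ D) [F.Faithful] :
    WideSubcategory (imageMorphisms F) ⥤ C where
  obj Z := Z.obj.property.witness
  map f := f.property.choose
  map_id Z := F.map_injective (by
    rw [(InducedWideCategory.Hom.property (𝟙 Z)).choose_spec]; simp)
  map_comp f g := F.map_injective (by
    rw [(InducedWideCategory.Hom.property (f ≫ g)).choose_spec, F.map_comp,
      f.property.choose_spec, g.property.choose_spec]; simp)

theorem map_imageFunctor_map (F : C ⥤ D) [F.Faithful] {Z Z' : WideSubcategory (imageMorphisms F)}
    (f : Z ⟶ Z') : F.map ((imageFunctor F).map f) =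
      Z.obj.property.getIso.hom ≫ f.hom.hom ≫ Z'.obj.property.getIso.inv :=
  f.property.choose_spec

instance (F : C ⥤ D) [F.Faithful] : (imageFunctor F).Faithful where
  map_injective {Z Z'} f f' h := by
    have h' := (map_imageFunctor_map F f).symm.trans
      ((congrArg F.map h).trans (map_imageFunctor_map F f'))
    exact WideSubcategory.hom_ext _ (ObjectProperty.hom_ext _
      ((cancel_mono _).1 ((cancel_epi _).1 h')))

instance (F : C ⥤ D) [F.Faithful] : (imageFunctor F).Full where
  map_surjective {Z Z'} (g : Z.obj.property.witness ⟶ Z'.obj.property.witness) := by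
    let f : Z ⟶ Z' := ⟨⟨Z.obj.property.getIso.inv ≫ F.map g ≫ Z'.obj.property.getIso.hom⟩,
      g, by simp⟩
    refine ⟨f, F.map_injective ?_⟩
    exact (map_imageFunctor_map F f).trans (by simp [f]; rfl)

/-- The source of a faithful functor which reflects isomorphism of objects is equivalent to a
subcategory of the target. -/
theorem exists_equivalence_wideSubcategory (F : C ⥤ D) [F.Faithful]
    (hF : ∀ X Y : C, Nonempty (F.obj X ≅ F.obj Y) → Nonempty (X ≅ Y)) :
    ∃ (P : ObjectProperty D) (W : MorphismProperty P.FullSubcategory) (_ : W.IsMultiplicative),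
      Nonempty (C ≌ WideSubcategory W) := by
  have : (imageFunctor F).EssSurj := ⟨fun X =>
    ⟨⟨⟨F.obj X, F.obj_mem_essImage X⟩⟩, hF _ _ ⟨(F.obj_mem_essImage X).getIso⟩⟩⟩
  have : (imageFunctor F).IsEquivalence := {}
  exact ⟨_, imageMorphisms F, inferInstance, ⟨(imageFunctor F).asEquivalence.symm⟩⟩

end Subcategory

section

open TwoMatrix TwoMat

/-! ### Rank matrices and isomorphisms of 2-matrices -/

namespace TwoMat

theorem mapRank_injective {n m : ℕ} :
    Function.Injective (mapRank : (Fin n → Fin m) → Fin m → Fin n → ℕ) := by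
  intro σ τ h
  funext j
  simpa [mapRank] using congrFun₂ h (σ j) j

/-- A complex matrix with a two-sided inverse is square, so isomorphic 1-morphisms have the same
rank matrix. -/
theorem rank_eq_of_iso {n m : TwoMat} {F G : n ⟶ m} (T : F ≅ G) : rank F = rank G := by
  funext i j
  have h₁ : Cell.entry T.inv i j * Cell.entry T.hom i j = 1 :=
    congrArg (fun S : F ⟶ F => Cell.entry S i j) T.hom_inv_id
  have h₂ : Cell.entry T.hom i j * Cell.entry T.inv i j = 1 :=
    congrArg (fun S : G ⟶ G => Cell.entry S i j) T.inv_hom_id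
  change Mor.rank F i j = Mor.rank G i j
  simpa using (Matrix.square_of_invertible _ _ h₂ h₁).symm

/-- One half of the fact that a matrix of natural numbers with an inverse of the same kind is a
permutation matrix. -/
theorem exists_eq_mapRank {n m : ℕ} {R : Fin m → Fin n → ℕ} {S : Fin n → Fin m → ℕ}
    (h : ∀ k j, ∑ i, S k i * R i j = if k = j then 1 else 0)
    (h' : ∀ k j, ∑ i, R k i * S i j = if k = j then 1 else 0) :
    ∃ σ : Fin n → Fin m, R = mapRank σ := by
  -- The diagonal entries of `S * R` are nonzero, so each of them has a nonzero summand.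
  have hne : ∀ j, ∃ i, S j i * R i j ≠ 0 := fun j => by
    by_contra! hc
    simpa [hc] using h j j
  choose σ hσ using hne
  refine ⟨σ, funext₂ fun i j => ?_⟩
  have hS : 0 < S j (σ j) := Nat.pos_of_ne_zero (left_ne_zero_of_mul (hσ j))
  -- In the `j`-th column, `R i j * S j (σ j)` is a summand of the entry `(i, σ j)` of `R * S = 1`.
  have hle : R i j * S j (σ j) ≤ if i = σ j then 1 else 0 := by
    rw [← h' i (σ j)]
    exact Finset.single_le_sum (f := fun k => R i k * S k (σ j)) (fun _ _ => Nat.zero_le _)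
      (Finset.mem_univ j)
  have hR : R i j ≤ R i j * S j (σ j) := Nat.le_mul_of_pos_right _ hS
  unfold mapRank
  split_ifs at hle ⊢ with hi
  · have : R i j ≠ 0 := by rw [hi]; exact right_ne_zero_of_mul (hσ j)
    omega
  · omega

/-- The rank matrix of an equivalence of 2-matrices is a permutation matrix. -/
theorem exists_equiv_rank_eq {n m : TwoMat} {F : n ⟶ m} {F' : m ⟶ n} (η : F ≫ F' ≅ 𝟙 n)
    (θ : F' ≫ F ≅ 𝟙 m) : ∃ σ : Fin n.dim ≃ Fin m.dim, rank F = mapRank σ := by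
  have h := rank_eq_of_iso η
  have h' := rank_eq_of_iso θ
  obtain ⟨σ, hσ⟩ := exists_eq_mapRank (congrFun₂ h) (congrFun₂ h')
  obtain ⟨τ, hτ⟩ := exists_eq_mapRank (congrFun₂ h') (congrFun₂ h)
  have hid : ∀ k : TwoMat, rank (𝟙 k) = mapRank (_root_.id : Fin k.dim → Fin k.dim) :=
    fun _ => rfl
  rw [rank_comp_mapRank hσ hτ, hid] at h
  rw [rank_comp_mapRank hτ hσ, hid] at h'
  exact ⟨⟨σ, τ, congrFun (mapRank_injective h), congrFun (mapRank_injective h')⟩, hσ⟩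

end TwoMat

/-! ### 2-morphisms with identity entries between 1-intertwiners -/

section Intertwiners

variable {G : Type u} [Category.{v} G] [MonoidalCategory G]

/-- All the naturality 2-isomorphisms of a 1-intertwiner have identity matrices as entries. -/
def HasIdNaturality {P Q : Rep2Mat G} (η : P ⟶ Q) : Prop :=
  ∀ (x y : Deloop G) (A : x ⟶ y), HasIdEntries (η.naturality A).hom

/-- All the entries of a modification between 1-intertwiners are identity matrices. -/
def IsIdModification {P Q : Rep2Mat G} {η θ : P ⟶ Q} (Γ : η ⟶ θ) : Prop :=
  ∀ x : Deloop G, HasIdEntries (Γ.as.app x)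

namespace IsIdModification

variable {P Q : Rep2Mat G} {η θ ι : P ⟶ Q}

theorem eq {Γ Γ' : η ⟶ θ} (h : IsIdModification Γ) (h' : IsIdModification Γ') : Γ = Γ' :=
  Pseudofunctor.StrongTrans.homCategory.ext fun x => (h x).eq (h' x)

theorem comp {Γ : η ⟶ θ} {Γ' : θ ⟶ ι} (h : IsIdModification Γ) (h' : IsIdModification Γ') :
    IsIdModification (Γ ≫ Γ') := fun x => (h x).comp (h' x)

theorem eqToHom (h : η = θ) : IsIdModification (CategoryTheory.eqToHom h) := by
  subst h
  exact fun x => HasIdEntries.id (η.app x)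

theorem whiskerRight {S : Rep2Mat G} {Γ : η ⟶ θ} (h : IsIdModification Γ) (κ : Q ⟶ S) :
    IsIdModification (Γ ▷ κ) := fun x => (h x).whiskerRight (κ.app x)

end IsIdModification

theorem hasIdNaturality_id (P : Rep2Mat G) : HasIdNaturality (𝟙 P) := fun _ _ A =>
  .comp (.rightUnitor_hom (P.map A)) (.leftUnitor_inv (P.map A))

theorem HasIdNaturality.eq {P Q : Rep2Mat G} {η θ : P ⟶ Q} (hη : HasIdNaturality η)
    (hθ : HasIdNaturality θ) (h : η.app = θ.app) : η = θ := by
  obtain ⟨app, N, _, _, _⟩ := η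
  obtain ⟨app', N', _, _, _⟩ := θ
  obtain rfl : app = app' := h
  obtain rfl : @N = @N' := funext fun x => funext fun y => funext fun A =>
    Iso.ext ((hη x y A).eq (hθ x y A))
  rfl

theorem isIdModification_associator_hom {P Q R S : Rep2Mat G} (η : P ⟶ Q) (θ : Q ⟶ R)
    (ι : R ⟶ S) : IsIdModification (α_ η θ ι).hom := fun x =>
  .associator_hom (η.app x) (θ.app x) (ι.app x)

theorem isIdModification_leftUnitor_hom {P Q : Rep2Mat G} (η : P ⟶ Q) :
    IsIdModification (λ_ η).hom := fun x => .leftUnitor_hom (η.app x)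

theorem isIdModification_rightUnitor_hom {P Q : Rep2Mat G} (η : P ⟶ Q) :
    IsIdModification (ρ_ η).hom := fun x => .rightUnitor_hom (η.app x)

variable [TwoGroup G] {n n' n'' : ℕ} {ρ : Pi0 G →* Equiv.Perm (Fin n)}
  {ρ' : Pi0 G →* Equiv.Perm (Fin n')} {ρ'' : Pi0 G →* Equiv.Perm (Fin n'')}

theorem hasIdNaturality_permIntertwiner (f : Fin n → Fin n') (hf : ∀ g i, f (ρ g i) = ρ' g (f i)) :
    HasIdNaturality (permIntertwiner f hf) := fun _ _ _ =>
  ⟨((rank_comp_mapRank (n := ⟨n⟩) (m := ⟨n⟩) (p := ⟨n'⟩) rfl rfl).trans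
    (congrArg mapRank (funext fun i => hf _ i))).trans
    (rank_comp_mapRank (n := ⟨n⟩) (m := ⟨n'⟩) (p := ⟨n'⟩) rfl rfl).symm, rfl⟩

/-- That the first 1-intertwiner is given by a map is needed for the left whiskering in the
naturality of the composite: with a general 1-morphism, it would involve the gauges. -/
theorem hasIdNaturality_comp (f : Fin n → Fin n') (hf : ∀ g i, f (ρ g i) = ρ' g (f i))
    (f' : Fin n' → Fin n'') (hf' : ∀ g i, f' (ρ' g i) = ρ'' g (f' i)) :
    HasIdNaturality (permIntertwiner f hf ≫ permIntertwiner f' hf') := fun x y A => by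
  have h := hasIdNaturality_permIntertwiner f hf x y A
  have h' := hasIdNaturality_permIntertwiner f' hf' x y A
  rw [Pseudofunctor.StrongTrans.categoryStruct_comp_naturality_hom]
  exact .comp (.associator_inv _ _ _) (.comp (h.whiskerRight _) (.comp (.associator_hom _ _ _)
    (.comp (.whiskerLeft (n := ⟨n⟩) (m := ⟨n'⟩) f h') (.associator_inv _ _ _))))

theorem permIntertwiner_id (h : ∀ g i, id (ρ g i) = ρ g (id i)) :
    permIntertwiner id h = 𝟙 (permRep n ρ) :=
  (hasIdNaturality_permIntertwiner id h).eq (hasIdNaturality_id _) rfl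

/-- Between 1-intertwiners with equal rank matrices and with trivial naturality 2-isomorphisms, the
invertible modification whose entries are identity matrices. -/
noncomputable def isoOfHasIdNaturality {Q : Rep2Mat G} {η θ : permRep n ρ ⟶ Q}
    (hη : HasIdNaturality η) (hθ : HasIdNaturality θ)
    (h : ∀ x, rank (η.app x) = rank (θ.app x)) : η ≅ θ :=
  Pseudofunctor.StrongTrans.isoMk (fun x => isoOfRankEq _ _ (h x)) fun {x y} A =>
    (HasIdEntries.comp (.whiskerLeft (n := ⟨n⟩) (m := ⟨n⟩) _ (.hom (h y))) (hθ x y A)).eq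
      ((hη x y A).comp (.whiskerRight (.hom (h x)) _))

theorem isIdModification_whiskerLeft {S : Rep2Mat G} (f : Fin n → Fin n')
    (hf : ∀ g i, f (ρ g i) = ρ' g (f i)) {η θ : permRep n' ρ' ⟶ S} {Γ : η ⟶ θ}
    (h : IsIdModification Γ) : IsIdModification (permIntertwiner f hf ◁ Γ) := fun x =>
  HasIdEntries.whiskerLeft (n := ⟨n⟩) (m := ⟨n'⟩) f (h x)

theorem rank_permIntertwiner_comp (f : Fin n → Fin n')
    (hf : ∀ g i, f (ρ g i) = ρ' g (f i)) (f' : Fin n' → Fin n'')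
    (hf' : ∀ g i, f' (ρ' g i) = ρ'' g (f' i)) (f'' : Fin n → Fin n'')
    (hf'' : ∀ g i, f'' (ρ g i) = ρ'' g (f'' i)) (h : f'' = f' ∘ f) (x : Deloop G) :
    rank ((permIntertwiner f'' hf'').app x) =
      rank ((permIntertwiner f hf ≫ permIntertwiner f' hf').app x) :=
  (congrArg mapRank h).trans
    (rank_comp_mapRank (n := ⟨n⟩) (m := ⟨n'⟩) (p := ⟨n''⟩) rfl rfl).symm

/-- For equivariant maps `f` and `f'`, the 2-isomorphism whose entries are identity matrices
between the 1-intertwiner of `f' ∘ f` and the composite of those of `f` and `f'`. The latter is not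
gauge trivial in general. -/
noncomputable def permIntertwinerComp (f : Fin n → Fin n') (hf : ∀ g i, f (ρ g i) = ρ' g (f i))
    (f' : Fin n' → Fin n'') (hf' : ∀ g i, f' (ρ' g i) = ρ'' g (f' i)) (f'' : Fin n → Fin n'')
    (hf'' : ∀ g i, f'' (ρ g i) = ρ'' g (f'' i)) (h : f'' = f' ∘ f) :
    permIntertwiner f'' hf'' ≅ permIntertwiner f hf ≫ permIntertwiner f' hf' :=
  isoOfHasIdNaturality (hasIdNaturality_permIntertwiner f'' hf'')
    (hasIdNaturality_comp f hf f' hf') (rank_permIntertwiner_comp f hf f' hf' f'' hf'' h)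

theorem isIdModification_permIntertwinerComp_hom (f : Fin n → Fin n')
    (hf : ∀ g i, f (ρ g i) = ρ' g (f i)) (f' : Fin n' → Fin n'')
    (hf' : ∀ g i, f' (ρ' g i) = ρ'' g (f' i)) (f'' : Fin n → Fin n'')
    (hf'' : ∀ g i, f'' (ρ g i) = ρ'' g (f'' i)) (h : f'' = f' ∘ f) :
    IsIdModification (permIntertwinerComp f hf f' hf' f'' hf'' h).hom :=
  fun x => .hom (rank_permIntertwiner_comp f hf f' hf' f'' hf'' h x)

theorem isIdModification_permIntertwinerComp_inv (f : Fin n → Fin n')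
    (hf : ∀ g i, f (ρ g i) = ρ' g (f i)) (f' : Fin n' → Fin n'')
    (hf' : ∀ g i, f' (ρ' g i) = ρ'' g (f' i)) (f'' : Fin n → Fin n'')
    (hf'' : ∀ g i, f'' (ρ g i) = ρ'' g (f'' i)) (h : f'' = f' ∘ f) :
    IsIdModification (permIntertwinerComp f hf f' hf' f'' hf'' h).inv :=
  fun x => .inv (rank_permIntertwiner_comp f hf f' hf' f'' hf'' h x)

end Intertwiners

/-! ### The pseudofunctor of permutational representations -/

section Pseudofunctor

variable {G : Type u} [Category.{v} G] [MonoidalCategory G] [TwoGroup G]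
  (e : ∀ S : FintypeCat.{w}, S ≃ Fin (Nat.card S))

theorem permPrefunctor_map_id (X : LocallyDiscrete (Action FintypeCat.{w} (Pi0 G))) :
    (permPrefunctor G e).map (𝟙 X) = 𝟙 ((permPrefunctor G e).obj X) := by
  have h : enumMap (e X.as.V) (e X.as.V) (𝟙 X.as) = id :=
    funext fun i => (e X.as.V).apply_symm_apply i
  have key : ∀ (f : _ → _) hf, f = id → permIntertwiner f hf =
      𝟙 (permRep (Nat.card X.as.V) (enumPerm X.as (e X.as.V))) := by
    rintro f hf rfl
    exact permIntertwiner_id hf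
  exact key _ (enumMap_equivariant _ _ (𝟙 X.as)) h

/-- The 2-isomorphism, with identity matrices as entries, between the images of a composite and the
composite of the images. -/
noncomputable def permPrefunctorComp
    {X Y Z : LocallyDiscrete (Action FintypeCat.{w} (Pi0 G))} (f : X ⟶ Y) (g : Y ⟶ Z) :
    (permPrefunctor G e).map (f ≫ g) ≅
      (permPrefunctor G e).map f ≫ (permPrefunctor G e).map g :=
  permIntertwinerComp _ (enumMap_equivariant _ _ f.as) _ (enumMap_equivariant _ _ g.as) _
    (enumMap_equivariant _ _ (f ≫ g).as) (funext fun _ => congrArg (fun y => e Z.as.V (g.as.hom y))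
      ((e Y.as.V).symm_apply_apply _).symm)

theorem isIdModification_permPrefunctorComp_hom
    {X Y Z : LocallyDiscrete (Action FintypeCat.{w} (Pi0 G))} (f : X ⟶ Y) (g : Y ⟶ Z) :
    IsIdModification (permPrefunctorComp e f g).hom :=
  isIdModification_permIntertwinerComp_hom _ (enumMap_equivariant _ _ f.as) _
    (enumMap_equivariant _ _ g.as) _ (enumMap_equivariant _ _ (f ≫ g).as) _

theorem isIdModification_permPrefunctorComp_inv
    {X Y Z : LocallyDiscrete (Action FintypeCat.{w} (Pi0 G))} (f : X ⟶ Y) (g : Y ⟶ Z) :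
    IsIdModification (permPrefunctorComp e f g).inv :=
  isIdModification_permIntertwinerComp_inv _ (enumMap_equivariant _ _ f.as) _
    (enumMap_equivariant _ _ g.as) _ (enumMap_equivariant _ _ (f ≫ g).as) _

theorem isIdModification_permPrefunctor_whiskerLeft
    {X Y : LocallyDiscrete (Action FintypeCat.{w} (Pi0 G))} (f : X ⟶ Y) {Q : Rep2Mat G}
    {η θ : (permPrefunctor G e).obj Y ⟶ Q} {Γ : η ⟶ θ} (h : IsIdModification Γ) :
    IsIdModification ((permPrefunctor G e).map f ◁ Γ) :=
  isIdModification_whiskerLeft _ (enumMap_equivariant _ _ f.as) h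

/-- The pseudofunctor which maps a finite set with an action of `π₀` to the corresponding purely
permutational representation. All of its structural 2-isomorphisms have identity matrices as
entries, so that the coherence conditions hold since there is at most one such 2-morphism between
two 1-intertwiners. -/
noncomputable def permPseudofunctor :
    LocallyDiscrete (Action FintypeCat.{w} (Pi0 G)) ⥤ᵖ Rep2Mat G where
  toPrefunctor := permPrefunctor G e
  map₂ η := eqToHom (congrArg (permPrefunctor G e).map (LocallyDiscrete.eq_of_hom η))
  mapId X := eqToIso (permPrefunctor_map_id e X)
  mapComp f g := permPrefunctorComp e f g
  map₂_whisker_left f _ _ η := (IsIdModification.eqToHom _).eq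
    (.comp (isIdModification_permPrefunctorComp_hom e _ _)
      (.comp (isIdModification_permPrefunctor_whiskerLeft e f (.eqToHom _))
        (isIdModification_permPrefunctorComp_inv e _ _)))
  map₂_whisker_right η g := (IsIdModification.eqToHom _).eq
    (.comp (isIdModification_permPrefunctorComp_hom e _ _)
      (.comp (.whiskerRight (.eqToHom _) _) (isIdModification_permPrefunctorComp_inv e _ _)))
  map₂_associator f g h := (IsIdModification.eqToHom _).eq
    (.comp (isIdModification_permPrefunctorComp_hom e _ _)
      (.comp (.whiskerRight (isIdModification_permPrefunctorComp_hom e _ _) _)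
        (.comp (isIdModification_associator_hom _ _ _)
          (.comp (isIdModification_permPrefunctor_whiskerLeft e f
            (isIdModification_permPrefunctorComp_inv e _ _))
              (isIdModification_permPrefunctorComp_inv e _ _)))))
  map₂_left_unitor f := (IsIdModification.eqToHom _).eq
    (.comp (isIdModification_permPrefunctorComp_hom e _ _)
      (.comp (.whiskerRight (.eqToHom (permPrefunctor_map_id e _)) _)
        (isIdModification_leftUnitor_hom _)))
  map₂_right_unitor f := (IsIdModification.eqToHom _).eq
    (.comp (isIdModification_permPrefunctorComp_hom e _ _)
      (.comp (isIdModification_permPrefunctor_whiskerLeft e f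
        (.eqToHom (permPrefunctor_map_id e _))) (isIdModification_rightUnitor_hom _)))

end Pseudofunctor

/-! ### The induced functor between homotopy categories -/

section Ho

variable {G : Type u} [Category.{v} G] [MonoidalCategory G] [TwoGroup G]

/-- An isomorphism in the homotopy category is represented by an equivalence. -/
theorem HoCat.exists_of_iso {B : Type u₁} [Bicategory.{w₁, v₁} B] {X Y : HoCat B} (i : X ≅ Y) :
    ∃ (f : X.as ⟶ Y.as) (g : Y.as ⟶ X.as),
      Nonempty (f ≫ g ≅ 𝟙 X.as) ∧ Nonempty (g ≫ f ≅ 𝟙 Y.as) := by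
  obtain ⟨p, q, h, h'⟩ := i
  obtain ⟨f⟩ := p
  obtain ⟨g⟩ := q
  exact ⟨f, g, Quotient.exact h, Quotient.exact h'⟩

/-- The component of an invertible modification at an object. -/
noncomputable def modificationIsoApp {P Q : Rep2Mat G} {η θ : P ⟶ Q} (Γ : η ≅ θ) (x : Deloop G) :
    η.app x ≅ θ.app x where
  hom := Γ.hom.as.app x
  inv := Γ.inv.as.app x
  hom_inv_id := congrArg (fun Γ' : η ⟶ η => Γ'.as.app x) Γ.hom_inv_id
  inv_hom_id := congrArg (fun Γ' : θ ⟶ θ => Γ'.as.app x) Γ.inv_hom_id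

/-- The rank matrix of an equivalence between permutational representations is the permutation
matrix of a bijection. Since the naturality 2-isomorphisms of the equivalence preserve rank
matrices, the bijection is equivariant. -/
theorem exists_equivariant_equiv {n n' : ℕ} {ρ : Pi0 G →* Equiv.Perm (Fin n)}
    {ρ' : Pi0 G →* Equiv.Perm (Fin n')} {η : permRep n ρ ⟶ permRep n' ρ'}
    {η' : permRep n' ρ' ⟶ permRep n ρ} (Γ : η ≫ η' ≅ 𝟙 (permRep n ρ))
    (Γ' : η' ≫ η ≅ 𝟙 (permRep n' ρ')) :
    ∃ σ : Fin n ≃ Fin n', ∀ g i, σ (ρ g i) = ρ' g (σ i) := by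
  let x : Deloop G := MonoidalSingleObj.star _
  obtain ⟨σ, hσ⟩ := exists_equiv_rank_eq (F := η.app x) (F' := η'.app x)
    (modificationIsoApp Γ x) (modificationIsoApp Γ' x)
  refine ⟨σ, fun g => ?_⟩
  obtain ⟨A, rfl⟩ : ∃ A : x ⟶ x, Deloop.cls A = g := by
    obtain ⟨A⟩ := g
    exact ⟨MonoidalOpposite.mop A, rfl⟩
  have h := rank_eq_of_iso (η.naturality A)
  rw [rank_comp_mapRank (F := (permRep n ρ).map A) rfl hσ,
    rank_comp_mapRank (G := (permRep n' ρ').map A) hσ rfl] at h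
  exact congrFun (mapRank_injective h)

/-- An equivariant bijection between enumerated finite sets gives an isomorphism. -/
theorem nonempty_iso_of_equivariant {H : Type u} [Group H] {X Y : Action FintypeCat.{w} H}
    {n n' : ℕ} (e : X.V ≃ Fin n) (e' : Y.V ≃ Fin n') (σ : Fin n ≃ Fin n')
    (hσ : ∀ g i, σ (enumPerm X e g i) = enumPerm Y e' g (σ i)) : Nonempty (X ≅ Y) := by
  refine ⟨Action.mkIso (FintypeCat.equivEquivIso (e.trans (σ.trans e'.symm))) fun g => ?_⟩
  ext x
  have h := hσ g (e x)
  rw [enumPerm_apply, enumPerm_apply, Equiv.symm_apply_apply] at h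
  exact (congrArg e'.symm h).trans (e'.symm_apply_apply _)

/-- Isomorphic 1-intertwiners have the same rank matrix, which determines the equivariant map. -/
theorem eq_of_permIntertwiner_iso {n n' : ℕ} {ρ : Pi0 G →* Equiv.Perm (Fin n)}
    {ρ' : Pi0 G →* Equiv.Perm (Fin n')} {f f' : Fin n → Fin n'}
    {hf : ∀ g i, f (ρ g i) = ρ' g (f i)} {hf' : ∀ g i, f' (ρ g i) = ρ' g (f' i)}
    (Γ : permIntertwiner f hf ≅ permIntertwiner f' hf') : f = f' :=
  mapRank_injective (rank_eq_of_iso (modificationIsoApp Γ (MonoidalSingleObj.star _)))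

variable (e : ∀ S : FintypeCat.{w}, S ≃ Fin (Nat.card S))

theorem faithful_hoCat_map_permPseudofunctor :
    (HoCat.ofLocallyDiscrete _ ⋙ HoCat.map (permPseudofunctor (G := G) e)).Faithful where
  map_injective {X Y f f'} h := by
    obtain ⟨Γ⟩ := Quotient.exact h
    have h' : enumMap (e X.V) (e Y.V) f = enumMap (e X.V) (e Y.V) f' :=
      eq_of_permIntertwiner_iso (hf := enumMap_equivariant _ _ f)
        (hf' := enumMap_equivariant _ _ f') Γ
    ext x
    simpa [enumMap] using congrFun h' (e X.V x)

theorem nonempty_iso_of_hoCat_iso (X Y : Action FintypeCat.{w} (Pi0 G))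
    (h : Nonempty ((HoCat.ofLocallyDiscrete _ ⋙ HoCat.map (permPseudofunctor (G := G) e)).obj X ≅
      (HoCat.ofLocallyDiscrete _ ⋙ HoCat.map (permPseudofunctor (G := G) e)).obj Y)) :
    Nonempty (X ≅ Y) := by
  obtain ⟨i⟩ := h
  obtain ⟨η, η', ⟨Γ⟩, ⟨Γ'⟩⟩ := HoCat.exists_of_iso i
  obtain ⟨σ, hσ⟩ := exists_equivariant_equiv Γ Γ'
  exact nonempty_iso_of_equivariant (e X.V) (e Y.V) σ hσ

end Ho

end

theorem mainTheorem4 {G : Type u} [Category.{v} G] [MonoidalCategory G] [TwoGroup G]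
    (e : ∀ S : FintypeCat.{w}, S ≃ Fin (Nat.card S)) :
    (∃ F : LocallyDiscrete (Action FintypeCat.{w} (Pi0 G)) ⥤ᵖ Rep2Mat G,
      F.toPrefunctor = permPrefunctor G e ∧
      (∃ h : ∀ X, F.map (𝟙 X) = 𝟙 (F.obj X), ∀ X, F.mapId X = eqToIso (h X)) ∧
      (∀ {X Y Z} (f : X ⟶ Y) (g : Y ⟶ Z) (x : Deloop G),
        TwoMat.HasIdEntries ((F.mapComp f g).hom.as.app x)) ∧
      (HoCat.ofLocallyDiscrete _ ⋙ HoCat.map F).Faithful ∧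
      ∀ X Y : Action FintypeCat.{w} (Pi0 G),
        Nonempty ((HoCat.ofLocallyDiscrete _ ⋙ HoCat.map F).obj X ≅
          (HoCat.ofLocallyDiscrete _ ⋙ HoCat.map F).obj Y) → Nonempty (X ≅ Y)) ∧
    ∃ (P : ObjectProperty (HoCat (Rep2Mat G))) (W : MorphismProperty P.FullSubcategory)
      (_ : W.IsMultiplicative),
      Nonempty (Action FintypeCat.{w} (Pi0 G) ≌ WideSubcategory W) := by
  have := faithful_hoCat_map_permPseudofunctor (G := G) e
  exact ⟨⟨permPseudofunctor e, rfl, ⟨permPrefunctor_map_id e, fun _ => rfl⟩,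
      fun f g => isIdModification_permPrefunctorComp_hom e f g, this,
      nonempty_iso_of_hoCat_iso e⟩,
    exists_equivalence_wideSubcategory _ (nonempty_iso_of_hoCat_iso e)⟩
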